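/- There exist an absolute constant $C>0$ and a randomized algorithm which, given a finite ground set $\mathcal N$ of size $n$, value-oracle access to a non-negative (not necessarily monotone) submodular function $f:2^{\mathcal N}\to\mathbb R_{\ge 0}$, an integer $k\ge 1$ and a real number $0<\varepsilon\le 1$, always outputs a set $S\subseteq\mathcal N$ with $|S|\le k$, such that $$\mathbb E[f(S)]\;\ge\;\Bigl(\frac1e-\varepsilon\Bigr)\cdot\max\{f(T):T\subseteq\mathcal N,\ |T|\le k\}.$$ Moreover, the expected number of value-oracle queries it makes is at most $$C\cdot\min\{B_1,B_2\},\qquad B_1=\frac{n}{\varepsilon^2}\ln\frac1\varepsilon,\qquad B_2=k\sqrt{\frac n\varepsilon\ln\frac k\varepsilon}+\frac n\varepsilon\ln\frac k\varepsilon,$$ and whenever $B_1\le B_2$, every run of the algorithm makes at most $C\cdot B_1$ queries. Here an algorithm is a randomized adaptive query procedure: each query is a subset $A\subseteq\mathcal N$ and is answered by $f(A)$, the procedure may depend on $n$, $k$, $\varepsilon$, the answers received so far and its own uniform random draws from finite sets, and only queries are counted. -/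

import Mathlib

/-- A randomized adaptive algorithm over the ground set `N` with access to a value oracle.
It may stop with a solution, query the oracle on a set and continue depending on the real number
answered, or draw a uniformly random element of a nonempty finite range and continue depending on
it. Only oracle queries are charged for. The algorithm does not see `f` except through the answers
to its queries. -/
inductive OracleAlg (N : Type) : Type where
  /-- stop and output a solution -/
  | done (output : Finset N) : OracleAlg N
  /-- ask the oracle for the value of a set -/
  | query (S : Finset N) (next : ℝ → OracleAlg N) : OracleAlg N
  /-- draw a uniformly random element of `{0, ..., m}` -/
  | toss (m : ℕ) (next : Fin (m + 1) → OracleAlg N) : OracleAlg N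

namespace OracleAlg

variable {N : Type}

/-- `expect f φ A` is the expectation of `φ S q`, where `S` is the output and `q` is the number of
queries in a random run of `A` with value oracle `f`. -/
noncomputable def expect (f : Finset N → ℝ) : (Finset N → ℕ → ℝ) → OracleAlg N → ℝ
  | φ, done S => φ S 0
  | φ, query S next => expect f (fun T q => φ T (q + 1)) (next (f S))
  | φ, toss m next => (∑ i : Fin (m + 1), expect f φ (next i)) / ((m : ℝ) + 1)

/-- `Always f P A` says that every possible run of `A` with value oracle `f` has `P S q`, where `S`
is the output and `q` is the number of queries of that run. -/
def Always (f : Finset N → ℝ) : (Finset N → ℕ → Prop) → OracleAlg N → Prop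
  | P, done S => P S 0
  | P, query S next => Always f (fun T q => P T (q + 1)) (next (f S))
  | P, toss m next => ∀ i : Fin (m + 1), Always f P (next i)

/-- The expected value of the output of `A`. -/
noncomputable def expectedValue (f : Finset N → ℝ) (A : OracleAlg N) : ℝ :=
  expect f (fun S _ => f S) A

/-- The expected number of value oracle queries made by `A`. -/
noncomputable def expectedQueries (f : Finset N → ℝ) (A : OracleAlg N) : ℝ :=
  expect f (fun _ q => (q : ℝ)) A

end OracleAlg

/-- Submodularity of a set function (no monotonicity and no normalization are assumed). -/
def IsSubmodular {N : Type} [DecidableEq N] (f : Finset N → ℝ) : Prop :=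
  ∀ S T : Finset N, f (S ∪ T) + f (S ∩ T) ≤ f S + f T

/-- `max {f(T) : |T| ≤ k}`. -/
noncomputable def optValue {N : Type} [Fintype N] (f : Finset N → ℝ) (k : ℕ) : ℝ :=
  (Finset.univ.filter fun T : Finset N => T.card ≤ k).sup' ⟨∅, by simp⟩ f

/-- The query bound `(n / ε²) ln (1 / ε)`. -/
noncomputable def samplingBound (n : ℕ) (ε : ℝ) : ℝ :=
  (n : ℝ) / ε ^ 2 * Real.log (1 / ε)

/-- The query bound `k √((n / ε) ln (k / ε)) + (n / ε) ln (k / ε)`. -/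
noncomputable def thresholdBound (n k : ℕ) (ε : ℝ) : ℝ :=
  (k : ℝ) * Real.sqrt ((n : ℝ) / ε * Real.log ((k : ℝ) / ε))
    + (n : ℝ) / ε * Real.log ((k : ℝ) / ε)

/-! Both query bounds come from variants of random greedy. Let `T` be an optimal set. Make `k`
steps, each inserting at most one element, and any given element with probability at most `1/k`.
Submodularity and non-negativity then keep the expected value of `f (S ∪ T)` from shrinking by more
than a factor `1 - 1/k` per step. If a step also gains `(f (S ∪ T) - f S)/k` on average, up to an
error, unrolling the two recurrences gives `(1 - 1/k)^(k-1) * f T ≥ f T / e` minus the total error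
(`le_mean_iter_of_empty`). Two step rules achieve this with few queries.

Sampling: draw about `q² n / k` elements with replacement, where `q ≈ 3/ε`, and insert a random one
of the `q²` best positions. The number of hits in a `k`-element superset of `T` has mean about `q²`
and deviation about `q`, so truncating it at `q²` loses only a fraction `ε` (`sum_min_hits_ge`); by
symmetry each hit is a uniform element of that superset (`card_mul_sum_weight_hits`).

Lazy evaluation: keep upper bounds `w` on the marginals, which stay valid as the solution grows, and
insert a random one of the `k` elements of largest bound. The step suffers only from outdated
bounds. Refreshing elements drawn roughly in proportion to `w` lowers `∑ log (w/δ)` by at least half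
the relative excess (`mean_logPotential_refresh_le`), so the total excess is controlled by the
initial potential `n log (k/ε)`. This costs `O((n/ε) log (k/ε))` queries, within the second summand
of the threshold bound.

Both procedures have worst-case query budgets, which settle the expected and the sure bounds
together. -/

/-- A randomized adaptive query procedure over the ground set `N` that returns a value of type `α`. -/
inductive OracleProg (N : Type) (α : Type) : Type where
  /-- stop and return a value -/
  | pure (a : α) : OracleProg N α
  /-- ask the oracle for the value of a set -/
  | query (S : Finset N) (next : ℝ → OracleProg N α) : OracleProg N α
  /-- draw a uniformly random element of `{0, ..., m}` -/
  | toss (m : ℕ) (next : Fin (m + 1) → OracleProg N α) : OracleProg N α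

namespace OracleProg

variable {N α β : Type}

/-- Run a procedure and continue with its result. -/
def bind : OracleProg N α → (α → OracleProg N β) → OracleProg N β
  | pure a, k => k a
  | query S next, k => query S fun r => bind (next r) k
  | toss m next, k => toss m fun i => bind (next i) k

/-- The expectation of `g` of the result, with value oracle `f`. -/
noncomputable def mean (f : Finset N → ℝ) (g : α → ℝ) : OracleProg N α → ℝ
  | pure a => g a
  | query S next => mean f g (next (f S))
  | toss m next => (∑ i : Fin (m + 1), mean f g (next i)) / ((m : ℝ) + 1)

/-- Every possible result with value oracle `f` satisfies `P`. -/
def Sure (f : Finset N → ℝ) (P : α → Prop) : OracleProg N α → Prop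
  | pure a => P a
  | query S next => Sure f P (next (f S))
  | toss m next => ∀ i : Fin (m + 1), Sure f P (next i)

/-- At most `q` queries are made, whatever the answers are. -/
def CostLE : OracleProg N α → ℕ → Prop
  | pure _, _ => True
  | query _ _, 0 => False
  | query _ next, q + 1 => ∀ r, CostLE (next r) q
  | toss m next, q => ∀ i : Fin (m + 1), CostLE (next i) q

/-- The algorithm that outputs the result of a procedure. -/
def run : OracleProg N (Finset N) → OracleAlg N
  | pure S => .done S
  | query S next => .query S fun r => run (next r)
  | toss m next => .toss m fun i => run (next i)

/-! ### Calculus of expectations, sure events and query budgets. -/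

variable {f : Finset N → ℝ}

theorem mean_bind (g : β → ℝ) (p : OracleProg N α) (k : α → OracleProg N β) :
    mean f g (p.bind k) = mean f (fun a => mean f g (k a)) p := by
  induction p with
  | pure a => rfl
  | query S next ih => exact ih _
  | toss m next ih => simp only [bind, mean, ih]

theorem sure_bind {P : β → Prop} {p : OracleProg N α} {k : α → OracleProg N β}
    (h : p.Sure f fun a => (k a).Sure f P) : (p.bind k).Sure f P := by
  induction p with
  | pure a => exact h
  | query S next ih => exact ih _ h
  | toss m next ih => exact fun i => ih i (h i)

theorem Sure.mono {P Q : α → Prop} {p : OracleProg N α} (h : p.Sure f P)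
    (hPQ : ∀ a, P a → Q a) : p.Sure f Q := by
  induction p with
  | pure a => exact hPQ a h
  | query S next ih => exact ih _ h
  | toss m next ih => exact fun i => ih i (h i)

theorem Sure.of_forall {P : α → Prop} (p : OracleProg N α) (h : ∀ a, P a) : p.Sure f P := by
  induction p with
  | pure a => exact h a
  | query S next ih => exact ih _
  | toss m next ih => exact fun i => ih i

theorem mean_mono_of_sure {g h : α → ℝ} {p : OracleProg N α}
    (hp : p.Sure f fun a => g a ≤ h a) : mean f g p ≤ mean f h p := by
  induction p with
  | pure a => exact hp
  | query S next ih => exact ih _ hp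
  | toss m next ih =>
    simp only [mean]
    gcongr with i
    exact ih i (hp i)

theorem mean_const (c : ℝ) (p : OracleProg N α) : mean f (fun _ => c) p = c := by
  induction p with
  | pure a => rfl
  | query S next ih => exact ih _
  | toss m next ih =>
    simp only [mean, ih, Finset.sum_const, Finset.card_univ, Fintype.card_fin, nsmul_eq_mul]
    push_cast
    field_simp

theorem mean_add (g h : α → ℝ) (p : OracleProg N α) :
    mean f (fun a => g a + h a) p = mean f g p + mean f h p := by
  induction p with
  | pure a => rfl
  | query S next ih => exact ih _
  | toss m next ih => simp only [mean, ih, Finset.sum_add_distrib, add_div]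

theorem mean_mul_left (c : ℝ) (g : α → ℝ) (p : OracleProg N α) :
    mean f (fun a => c * g a) p = c * mean f g p := by
  induction p with
  | pure a => rfl
  | query S next ih => exact ih _
  | toss m next ih => simp only [mean, ih, ← Finset.mul_sum, mul_div_assoc]

theorem mean_sub (g h : α → ℝ) (p : OracleProg N α) :
    mean f (fun a => g a - h a) p = mean f g p - mean f h p := by
  have := mean_add (f := f) (fun a => g a - h a) h p
  simp only [sub_add_cancel] at this
  linarith

theorem CostLE.mono {p : OracleProg N α} {a b : ℕ} (hp : p.CostLE a) (hab : a ≤ b) :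
    p.CostLE b := by
  induction p generalizing a b with
  | pure _ => trivial
  | query S next ih =>
    cases a with
    | zero => exact hp.elim
    | succ a =>
      cases b with
      | zero => omega
      | succ b => exact fun r => ih r (hp r) (by omega)
  | toss m next ih => exact fun i => ih i (hp i) hab

theorem CostLE.bind {p : OracleProg N α} {k : α → OracleProg N β} {a b : ℕ}
    (hp : p.CostLE a) (hk : ∀ x, (k x).CostLE b) : (p.bind k).CostLE (a + b) := by
  induction p generalizing a with
  | pure x => exact (hk x).mono (Nat.le_add_left _ _)
  | query S next ih =>
    cases a with
    | zero => exact hp.elim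
    | succ a =>
      rw [Nat.succ_add]
      exact fun r => ih r (hp r)
  | toss m next ih => exact fun i => ih i (hp i)

theorem expect_run (g : Finset N → ℝ) (p : OracleProg N (Finset N)) :
    OracleAlg.expect f (fun S _ => g S) p.run = mean f g p := by
  induction p with
  | pure a => rfl
  | query S next ih => exact ih _
  | toss m next ih => simp only [run, OracleAlg.expect, mean, ih]

theorem always_run {P : Finset N → Prop} {p : OracleProg N (Finset N)} {q : ℕ}
    (hP : p.Sure f P) (hq : p.CostLE q) {Q : Finset N → ℕ → Prop}
    (hQ : ∀ S c, P S → c ≤ q → Q S c) : p.run.Always f Q := by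
  induction p generalizing q Q with
  | pure a => exact hQ a 0 hP (Nat.zero_le _)
  | query S next ih =>
    cases q with
    | zero => exact hq.elim
    | succ q => exact ih _ hP (hq _) fun S c hS hc => hQ S (c + 1) hS (by omega)
  | toss m next ih => exact fun i => ih i (hP i) (hq i) hQ

/-- Derives the expected query count from the worst-case budget. -/
theorem _root_.OracleAlg.expect_le_of_always {φ : Finset N → ℕ → ℝ} {c : ℝ} {A : OracleAlg N}
    (h : A.Always f fun S q => φ S q ≤ c) : OracleAlg.expect f φ A ≤ c := by
  induction A generalizing φ with
  | done S => exact h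
  | query S next ih => exact ih _ h
  | toss m next ih =>
    simp only [OracleAlg.expect]
    rw [div_le_iff₀ (by positivity)]
    calc _ ≤ ∑ _i : Fin (m + 1), c := Finset.sum_le_sum fun i _ => ih i (h i)
      _ = c * (m + 1) := by simp [mul_comm]

/-! ### Basic procedures: queries, uniform draws, iteration. -/

/-- Query a single set. -/
def ask (S : Finset N) : OracleProg N ℝ := query S pure

@[simp] theorem mean_ask (g : ℝ → ℝ) (S : Finset N) : mean f g (ask S) = g (f S) := rfl

theorem sure_ask {P : ℝ → Prop} {S : Finset N} (h : P (f S)) : (ask S).Sure f P := h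

theorem costLE_ask (S : Finset N) : (ask S).CostLE 1 := fun _ => trivial

/-- Query a finite family of sets. -/
def askAll : (m : ℕ) → (Fin m → Finset N) → OracleProg N (Fin m → ℝ)
  | 0, _ => pure Fin.elim0
  | m + 1, A => query (A 0) fun r => (askAll m fun i => A i.succ).bind fun y => pure (Fin.cons r y)

theorem mean_askAll {m : ℕ} (g : (Fin m → ℝ) → ℝ) (A : Fin m → Finset N) :
    mean f g (askAll m A) = g fun i => f (A i) := by
  induction m with
  | zero => exact congrArg g (Subsingleton.elim _ _)
  | succ m ih =>
    simp only [askAll, mean, mean_bind, ih]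
    congr 1
    ext i
    exact Fin.cases rfl (fun _ => rfl) i

theorem sure_askAll {m : ℕ} {P : (Fin m → ℝ) → Prop} {A : Fin m → Finset N}
    (h : P fun i => f (A i)) : (askAll m A).Sure f P := by
  induction m with
  | zero => exact (congrArg P (Subsingleton.elim _ _)).mp h
  | succ m ih =>
    refine sure_bind (ih ?_)
    refine (congrArg P ?_).mp h
    ext i
    exact Fin.cases rfl (fun _ => rfl) i

theorem costLE_askAll (m : ℕ) (A : Fin m → Finset N) : (askAll m A).CostLE m := by
  induction m with
  | zero => trivial
  | succ m ih => exact fun r => CostLE.bind (b := 0) (ih _) fun _ => trivial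

/-- Draw a uniformly random element of a nonempty finite set. -/
noncomputable def uniform (P : Finset α) (h : P.Nonempty) : OracleProg N α :=
  toss (P.card - 1) fun i => pure
    (P.equivFin.symm ⟨i, by have := i.2; have := h.card_pos; omega⟩ : P).1

theorem mean_uniform (g : α → ℝ) (P : Finset α) (h : P.Nonempty) :
    mean f g (uniform P h) = (∑ a ∈ P, g a) / P.card := by
  have hc : P.card - 1 + 1 = P.card := by have := h.card_pos; omega
  simp only [uniform, mean]
  have hc' : ((P.card - 1 : ℕ) : ℝ) + 1 = P.card := by exact_mod_cast hc
  rw [hc']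
  congr 1
  rw [← Finset.sum_coe_sort P g]
  exact Fintype.sum_equiv ((finCongr hc).trans P.equivFin.symm) _ _ fun _ => rfl

theorem costLE_uniform (P : Finset α) (h : P.Nonempty) :
    (uniform P h : OracleProg N α).CostLE 0 := fun _ => trivial

/-- Apply a randomized step a fixed number of times. -/
def iter (step : α → OracleProg N α) : ℕ → α → OracleProg N α
  | 0, a => pure a
  | r + 1, a => (step a).bind (iter step r)

theorem mean_iter_succ (step : α → OracleProg N α) (g : α → ℝ) (r : ℕ) (a : α) :
    mean f g (iter step (r + 1) a) = mean f (fun b => mean f g (iter step r b)) (step a) :=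
  mean_bind _ _ _

theorem mean_iter_add (step : α → OracleProg N α) (g : α → ℝ) (r t : ℕ) (a : α) :
    mean f (fun b => mean f g (iter step t b)) (iter step r a) = mean f g (iter step (r + t) a) := by
  induction r generalizing a with
  | zero => rw [Nat.zero_add]; rfl
  | succ r ih => rw [Nat.succ_add, mean_iter_succ, mean_iter_succ]; simp only [ih]

theorem costLE_iter {step : α → OracleProg N α} {q : ℕ} (h : ∀ a, (step a).CostLE q) (r : ℕ)
    (a : α) : (iter step r a).CostLE (r * q) := by
  induction r generalizing a with
  | zero => trivial
  | succ r ih =>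
    rw [Nat.succ_mul, Nat.add_comm (r * q)]
    exact CostLE.bind (h a) ih

theorem sure_iter {step : α → OracleProg N α} {P : ℕ → α → Prop}
    (h : ∀ i a, P i a → (step a).Sure f (P (i + 1))) (r : ℕ) {i : ℕ} {a : α} (ha : P i a) :
    (iter step r a).Sure f (P (i + r)) := by
  induction r generalizing a i with
  | zero => exact ha
  | succ r ih =>
    refine sure_bind ((h i a ha).mono fun b hb => ?_)
    have := ih hb
    rwa [Nat.add_assoc, Nat.add_comm 1 r] at this

end OracleProg

/-! ### Consequences of submodularity. -/

namespace IsSubmodular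

variable {N : Type} [DecidableEq N] {f : Finset N → ℝ}

theorem marginal_anti (hf : IsSubmodular f) {A B : Finset N} (hAB : A ⊆ B) {u : N} (hu : u ∉ B) :
    f (insert u B) - f B ≤ f (insert u A) - f A := by
  have h := hf (insert u A) B
  have h1 : insert u A ∪ B = insert u B := by
    rw [Finset.insert_union, Finset.union_eq_right.mpr hAB]
  have h2 : insert u A ∩ B = A := by
    rw [Finset.insert_inter_of_notMem hu, Finset.inter_eq_left.mpr hAB]
  rw [h1, h2] at h
  linarith

theorem union_sub_le_sum (hf : IsSubmodular f) (R B : Finset N) :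
    f (R ∪ B) - f R ≤ ∑ u ∈ B, (f (insert u R) - f R) := by
  induction B using Finset.induction_on with
  | empty => simp
  | insert u B hu ih =>
    rw [Finset.sum_insert hu, Finset.union_insert]
    by_cases h : u ∈ R ∪ B
    · rw [Finset.insert_eq_of_mem h]
      have : u ∈ R := by
        rcases Finset.mem_union.mp h with h | h
        · exact h
        · exact absurd h hu
      rw [Finset.insert_eq_of_mem this]
      linarith
    · have := hf.marginal_anti (Finset.subset_union_left (s₁ := R) (s₂ := B)) h
      linarith

/-- Adding each element with probability at most `1 / k`, at most one at a time, costs at most a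
fraction `1 / k` of the value. -/
theorem neg_le_sum_mul_marginal [Fintype N] (hf : IsSubmodular f) (h0 : ∀ S, 0 ≤ f S)
    {p : ℝ} (hp : 0 ≤ p) {q : N → ℝ} (hq : ∀ u, q u ≤ p) (R : Finset N) :
    -(p * f R) ≤ ∑ u, q u * min 0 (f (insert u R) - f R) := by
  -- The worst case inserts exactly the elements of negative marginal. Together they lose at most `f
  -- R`, because `f (R ∪ B)` is non-negative.
  set B := Finset.univ.filter fun u => f (insert u R) - f R < 0
  have h1 : ∑ u, p * min 0 (f (insert u R) - f R) ≤ ∑ u, q u * min 0 (f (insert u R) - f R) :=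
    Finset.sum_le_sum fun u _ => mul_le_mul_of_nonpos_right (hq u) (min_le_left _ _)
  have h2 : ∑ u, min 0 (f (insert u R) - f R) = ∑ u ∈ B, (f (insert u R) - f R) := by
    rw [Finset.sum_filter]
    refine Finset.sum_congr rfl fun u _ => ?_
    split_ifs with h
    · exact min_eq_right h.le
    · exact min_eq_left (not_lt.mp h)
  rw [← Finset.mul_sum, h2] at h1
  have h3 := hf.union_sub_le_sum R B
  nlinarith [h0 (R ∪ B), mul_le_mul_of_nonneg_left h3 hp, mul_nonneg hp (h0 (R ∪ B))]

/-- Turns an error relative to the gain into an error relative to `f T`. -/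
theorem union_sub_le (hf : IsSubmodular f) (h0 : ∀ S, 0 ≤ f S) (S T : Finset N) :
    f (S ∪ T) - f S ≤ f T := by
  have := hf S T
  have := h0 (S ∩ T)
  linarith

end IsSubmodular

/-! ### Heaviest subsets of prescribed size. -/

/-- A subset of size `s` of largest total weight. -/
noncomputable def heaviest {α : Type} [Fintype α] (s : ℕ) (hs : s ≤ Fintype.card α) (w : α → ℝ) :
    Finset α :=
  (Finset.exists_max_image (Finset.powersetCard s Finset.univ) (fun P => ∑ a ∈ P, w a)
    (Finset.powersetCard_nonempty.mpr (by simpa using hs))).choose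

section heaviest

variable {α : Type} [Fintype α] {s : ℕ} (hs : s ≤ Fintype.card α) (w : α → ℝ)

theorem card_heaviest : (heaviest s hs w).card = s :=
  (Finset.mem_powersetCard.mp (Finset.exists_max_image (Finset.powersetCard s Finset.univ)
    (fun P => ∑ a ∈ P, w a)
    (Finset.powersetCard_nonempty.mpr (by simpa using hs))).choose_spec.1).2

theorem sum_le_sum_heaviest_of_card_eq {B : Finset α} (hB : B.card = s) :
    ∑ a ∈ B, w a ≤ ∑ a ∈ heaviest s hs w, w a :=
  (Finset.exists_max_image (Finset.powersetCard s Finset.univ) (fun P => ∑ a ∈ P, w a)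
    (Finset.powersetCard_nonempty.mpr (by simpa using hs))).choose_spec.2 B
      (Finset.mem_powersetCard.mpr ⟨Finset.subset_univ _, hB⟩)

theorem sum_le_sum_heaviest (hw : ∀ a, 0 ≤ w a) {B : Finset α} (hB : B.card ≤ s) :
    ∑ a ∈ B, w a ≤ ∑ a ∈ heaviest s hs w, w a := by
  classical
  obtain ⟨B', hBB', -, hB'⟩ := Finset.exists_subsuperset_card_eq (Finset.subset_univ B) hB
    (by simpa using hs)
  exact (Finset.sum_le_sum_of_subset_of_nonneg hBB' fun a _ _ => hw a).trans
    (sum_le_sum_heaviest_of_card_eq hs w hB')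

end heaviest

/-- With `k = j + 1` the base is the inverse of `1 + 1/j`, and `(1 + 1/j)^j ≤ e`. For `k = 1` the
base is `0` and the exponent `0`. -/
theorem exp_neg_one_le_one_sub_inv_pow {k : ℕ} (hk : 1 ≤ k) :
    1 / Real.exp 1 ≤ (1 - 1 / (k : ℝ)) ^ (k - 1) := by
  obtain ⟨j, rfl⟩ : ∃ j, k = j + 1 := ⟨k - 1, by omega⟩
  simp only [Nat.add_sub_cancel]
  rcases Nat.eq_zero_or_pos j with rfl | hj
  · simp only [pow_zero]
    rw [div_le_one (Real.exp_pos _)]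
    exact Real.one_le_exp zero_le_one
  have hj' : (0 : ℝ) < j := by exact_mod_cast hj
  have h1 : (1 - 1 / ((j + 1 : ℕ) : ℝ)) = (1 + 1 / (j : ℝ))⁻¹ := by
    push_cast
    field_simp
    ring
  rw [h1, inv_pow, one_div]
  refine inv_anti₀ (by positivity) ?_
  calc (1 + 1 / (j : ℝ)) ^ j ≤ (Real.exp (1 / j)) ^ j := by
        gcongr
        rw [add_comm]
        exact Real.add_one_le_exp _
    _ = Real.exp 1 := by
        rw [← Real.exp_nat_mul]
        congr 1
        field_simp

/-! ### The random greedy recurrence. -/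

namespace OracleProg

variable {N : Type} [DecidableEq N] {f : Finset N → ℝ} {σ : Type}

/-- Value of a sequence of approximate random greedy steps. The error `loss` of a step is paid for
by a decrease of the potential `pot`. -/
theorem le_mean_iter {step : σ → OracleProg N σ} {sol : σ → Finset N} {Inv : σ → Prop}
    {pot loss : σ → ℝ} {err : ℝ} {T : Finset N} {k : ℕ} (hk : 1 ≤ k)
    (hinv : ∀ a, Inv a → (step a).Sure f Inv)
    (hgain : ∀ a, Inv a → f (sol a) + (f (sol a ∪ T) - f (sol a)) / k - loss a - err
      ≤ mean f (fun b => f (sol b)) (step a))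
    (hunion : ∀ a, Inv a → (1 - 1 / (k : ℝ)) * f (sol a ∪ T)
      ≤ mean f (fun b => f (sol b ∪ T)) (step a))
    (hpot : ∀ a, Inv a → mean f pot (step a) ≤ pot a - loss a)
    (hpot0 : ∀ a, Inv a → 0 ≤ pot a) (hloss : ∀ a, Inv a → 0 ≤ loss a) (herr : 0 ≤ err) (r : ℕ) :
    ∀ a, Inv a → (1 - 1 / (k : ℝ)) ^ r * f (sol a)
      + r / k * (1 - 1 / (k : ℝ)) ^ (r - 1) * f (sol a ∪ T) - pot a - r * err
      ≤ mean f (fun b => f (sol b)) (iter step r a) := by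
  have hk0 : (1 : ℝ) ≤ k := by exact_mod_cast hk
  have hx0 : 0 ≤ 1 - 1 / (k : ℝ) := by
    rw [sub_nonneg, div_le_one (by linarith)]
    exact hk0
  have hx1 : 1 - 1 / (k : ℝ) ≤ 1 := by
    have : 0 ≤ 1 / (k : ℝ) := by positivity
    linarith
  induction r with
  | zero =>
    intro a ha
    have := hpot0 a ha
    simp [iter, mean]
    linarith
  | succ r ih =>
    intro a ha
    rw [mean_iter_succ]
    refine le_trans ?_ (mean_mono_of_sure ((hinv a ha).mono ih))
    rw [mean_sub, mean_sub, mean_add, mean_mul_left, mean_mul_left, mean_const]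
    have hg := mul_le_mul_of_nonneg_left (hgain a ha) (pow_nonneg hx0 r)
    have hb0 : 0 ≤ r / k * (1 - 1 / (k : ℝ)) ^ (r - 1) := by positivity
    have hu := mul_le_mul_of_nonneg_left (hunion a ha) hb0
    have hp := hpot a ha
    -- The coefficient of `f (sol a ∪ T)` collects the gain of the first step, discounted by the
    -- other `r`, and the coefficient for those `r` steps, shrunk once. The case `r = 0` is separate
    -- because `r - 1` truncates.
    have hb : ((r + 1 : ℕ) : ℝ) / k * (1 - 1 / (k : ℝ)) ^ (r + 1 - 1)
        = (1 - 1 / (k : ℝ)) ^ r / k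
          + r / k * (1 - 1 / (k : ℝ)) ^ (r - 1) * (1 - 1 / (k : ℝ)) := by
      cases r with
      | zero => simp
      | succ r =>
        simp only [Nat.add_sub_cancel]
        rw [mul_assoc (((r + 1 : ℕ) : ℝ) / k), ← pow_succ]
        push_cast
        ring
    rw [hb]
    -- Losses are charged undiscounted, so the potential pays for them in full.
    have hpw : (1 - 1 / (k : ℝ)) ^ r ≤ 1 := pow_le_one₀ hx0 hx1
    have hl := mul_le_mul_of_nonneg_right hpw (add_nonneg (hloss a ha) herr)
    have e1 : (1 - 1 / (k : ℝ)) ^ r * (f (sol a) + (f (sol a ∪ T) - f (sol a)) / k - loss a - err)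
      = (1 - 1 / (k : ℝ)) ^ (r + 1) * f (sol a) + (1 - 1 / (k : ℝ)) ^ r / k * f (sol a ∪ T)
        - (1 - 1 / (k : ℝ)) ^ r * (loss a + err) := by
      rw [pow_succ]; ring
    rw [e1] at hg
    push_cast
    nlinarith

/-- Start from the empty set and make `k` approximate random greedy steps. -/
theorem le_mean_iter_of_empty {step : σ → OracleProg N σ} {sol : σ → Finset N} {Inv : σ → Prop}
    {pot loss : σ → ℝ} {err : ℝ} {T : Finset N} {k : ℕ} (hk : 1 ≤ k) (h0 : ∀ S, 0 ≤ f S)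
    (hinv : ∀ a, Inv a → (step a).Sure f Inv)
    (hgain : ∀ a, Inv a → f (sol a) + (f (sol a ∪ T) - f (sol a)) / k - loss a - err
      ≤ mean f (fun b => f (sol b)) (step a))
    (hunion : ∀ a, Inv a → (1 - 1 / (k : ℝ)) * f (sol a ∪ T)
      ≤ mean f (fun b => f (sol b ∪ T)) (step a))
    (hpot : ∀ a, Inv a → mean f pot (step a) ≤ pot a - loss a)
    (hpot0 : ∀ a, Inv a → 0 ≤ pot a) (hloss : ∀ a, Inv a → 0 ≤ loss a) (herr : 0 ≤ err)
    {a : σ} (ha : Inv a) (hsol : sol a = ∅) :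
    1 / Real.exp 1 * f T - pot a - k * err ≤ mean f (fun b => f (sol b)) (iter step k a) := by
  refine le_trans ?_ (le_mean_iter hk hinv hgain hunion hpot hpot0 hloss herr k a ha)
  have hk0 : (1 : ℝ) ≤ k := by exact_mod_cast hk
  have hx0 : 0 ≤ 1 - 1 / (k : ℝ) := by
    rw [sub_nonneg, div_le_one (by linarith)]
    exact hk0
  have h1 := mul_le_mul_of_nonneg_right (exp_neg_one_le_one_sub_inv_pow hk) (h0 T)
  have h2 := mul_nonneg (pow_nonneg hx0 k) (h0 ∅)
  rw [hsol, Finset.empty_union, div_self (by linarith), one_mul]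
  linarith

end OracleProg

/-! ### Hits of a random sample and their first two moments. -/

section Hits

variable {N : Type} [DecidableEq N]

/-- The number of positions of a sample that hold an element of `T`. -/
def hits {m : ℕ} (T : Finset N) (x : Fin m → N) : ℕ :=
  (Finset.univ.filter fun j => x j ∈ T).card

theorem hits_eq_sum {m : ℕ} (T : Finset N) (x : Fin m → N) :
    (hits T x : ℝ) = ∑ j, if x j ∈ T then (1 : ℝ) else 0 := by
  simp [hits]

theorem sum_filter_eq_sum_hits {m : ℕ} (T : Finset N) (w : N → ℝ) (x : Fin m → N) :
    ∑ j ∈ Finset.univ.filter (fun j => x j ∈ T), w (x j) = ∑ t ∈ T, hits {t} x * w t := by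
  have : ∀ j ∈ Finset.univ.filter (fun j => x j ∈ T), x j ∈ T := by simp
  rw [← Finset.sum_fiberwise_of_maps_to this]
  refine Finset.sum_congr rfl fun t ht => ?_
  rw [Finset.filter_filter]
  have e : (Finset.univ.filter fun j => x j ∈ T ∧ x j = t)
      = Finset.univ.filter fun j => x j ∈ ({t} : Finset N) := by
    ext j
    simp only [Finset.mem_filter, Finset.mem_univ, true_and, Finset.mem_singleton]
    exact ⟨fun h => h.2, fun h => ⟨h ▸ ht, h⟩⟩
  rw [e, hits, ← nsmul_eq_mul, ← Finset.sum_const]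
  refine Finset.sum_congr rfl fun j hj => ?_
  simp only [Finset.mem_filter, Finset.mem_univ, true_and, Finset.mem_singleton] at hj
  rw [hj]

theorem sum_hits_singleton {m : ℕ} (T : Finset N) (x : Fin m → N) :
    ∑ t ∈ T, (hits {t} x : ℝ) = hits T x := by
  have := sum_filter_eq_sum_hits T (fun _ => 1) x
  simp only [mul_one, Finset.sum_const, nsmul_eq_mul] at this
  rw [← this, hits]

end Hits

section SampleMoments

variable {N : Type} [Fintype N]

theorem sum_fin_succ_fun {m : ℕ} (g : (Fin (m + 1) → N) → ℝ) :
    ∑ x, g x = ∑ a, ∑ y : Fin m → N, g (Fin.cons a y) := by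
  rw [← Fintype.sum_prod_type' fun (a : N) (y : Fin m → N) => g (Fin.cons a y)]
  exact (Fintype.sum_equiv (Fin.consEquiv fun _ => N) _ _ fun _ => rfl).symm

theorem sum_fun_sum (m : ℕ) (h : N → ℝ) :
    Fintype.card N * ∑ x : Fin m → N, ∑ j, h (x j)
      = (m * ∑ a, h a) * (Fintype.card N : ℝ) ^ m := by
  induction m with
  | zero => simp
  | succ m ih =>
    rw [sum_fin_succ_fun]
    simp only [Fin.sum_univ_succ, Fin.cons_zero, Fin.cons_succ, Finset.sum_add_distrib,
      Finset.sum_const, Finset.card_univ, nsmul_eq_mul, Fintype.card_fun, Fintype.card_fin,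
      ← Finset.mul_sum]
    push_cast
    rw [mul_add, ih]
    ring

/-- Expanding the square gives `m` diagonal terms and `m (m - 1)` pairs of independent coordinates;
denominators are cleared. -/
theorem sum_fun_sum_sq (m : ℕ) (h : N → ℝ) :
    (Fintype.card N : ℝ) ^ 2 * ∑ x : Fin m → N, (∑ j, h (x j)) ^ 2
      = (m * (∑ a, h a ^ 2) * Fintype.card N + m * (m - 1) * (∑ a, h a) ^ 2)
        * (Fintype.card N : ℝ) ^ m := by
  induction m with
  | zero => simp
  | succ m ih =>
    have h1 := sum_fun_sum m h
    rw [sum_fin_succ_fun]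
    simp only [Fin.sum_univ_succ, Fin.cons_zero, Fin.cons_succ, add_sq, Finset.sum_add_distrib,
      Finset.sum_const, Finset.card_univ, nsmul_eq_mul, Fintype.card_fun, Fintype.card_fin,
      ← Finset.mul_sum, ← Finset.sum_mul]
    push_cast
    rw [mul_add, mul_add]
    have e1 : (Fintype.card N : ℝ) ^ 2 * (Fintype.card N * ∑ x : Fin m → N, (∑ j, h (x j)) ^ 2)
        = Fintype.card N * ((Fintype.card N : ℝ) ^ 2 * ∑ x : Fin m → N, (∑ j, h (x j)) ^ 2) := by
      ring
    have e2 : (Fintype.card N : ℝ) ^ 2 *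
          ((2 * ∑ i, h i) * ∑ x : Fin m → N, ∑ j, h (x j))
        = Fintype.card N * (2 * ∑ i, h i) *
          (Fintype.card N * ∑ x : Fin m → N, ∑ j, h (x j)) := by ring
    rw [e1, ih, e2, h1]
    ring

variable [DecidableEq N]

theorem card_mul_sum_hits (m : ℕ) (T : Finset N) :
    Fintype.card N * ∑ x : Fin m → N, (hits T x : ℝ)
      = (m * T.card) * (Fintype.card N : ℝ) ^ m := by
  have := sum_fun_sum m fun a => if a ∈ T then (1 : ℝ) else 0
  simpa [hits_eq_sum] using this

theorem card_sq_mul_sum_hits_sq (m : ℕ) (T : Finset N) :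
    (Fintype.card N : ℝ) ^ 2 * ∑ x : Fin m → N, (hits T x : ℝ) ^ 2
      = (m * T.card * Fintype.card N + m * (m - 1) * (T.card : ℝ) ^ 2)
        * (Fintype.card N : ℝ) ^ m := by
  have := sum_fun_sum_sq m fun a => if a ∈ T then (1 : ℝ) else 0
  simpa [hits_eq_sum] using this

/-- A quadratic minorant of the truncation, by AM-GM on `X - s`, so that two moments suffice to
bound its mean. -/
theorem le_min_of_sq {X s q : ℝ} (hq : 0 < q) :
    X - (X - s) ^ 2 / (2 * q) - q / 2 ≤ min X s := by
  have h : 0 ≤ (X - s) ^ 2 / (2 * q) := by positivity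
  refine le_min (by linarith) ?_
  have : (X - s) ≤ (X - s) ^ 2 / (2 * q) + q / 2 := by
    have e : (X - s) ^ 2 / (2 * q) + q / 2 - (X - s) = (X - s - q) ^ 2 / (2 * q) := by
      field_simp
      ring
    have : 0 ≤ (X - s - q) ^ 2 / (2 * q) := by positivity
    linarith
  linarith

/-- A sample of `m ≈ n q² / |T|` elements hits `T` at least `(1 - ε) q²` times on average, even if
hits beyond the first `q²` do not count. -/
theorem sum_min_hits_ge {m q : ℕ} {ε : ℝ} (hε : 0 < ε) (hq : 3 / ε ≤ q) {T : Finset N}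
    (hε1 : ε ≤ 1) (hm1 : (m : ℝ) * T.card ≤ (q : ℝ) ^ 2 * Fintype.card N)
    (hm2 : ((q : ℝ) ^ 2 - 1) * Fintype.card N ≤ (m : ℝ) * T.card) (hN : 0 < Fintype.card N) :
    (1 - ε) * (q : ℝ) ^ 2 * (Fintype.card N : ℝ) ^ m
      ≤ ∑ x : Fin m → N, min (hits T x : ℝ) ((q : ℝ) ^ 2) := by
  have hn : (0 : ℝ) < Fintype.card N := by exact_mod_cast hN
  have hq3 : (3 : ℝ) ≤ q := by
    refine le_trans ?_ hq
    rw [le_div_iff₀ hε]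
    linarith
  have hεq : 3 ≤ q * ε := by rwa [div_le_iff₀ hε] at hq
  have h1 := card_mul_sum_hits m T
  have h2 := card_sq_mul_sum_hits_sq m T
  set n : ℝ := ((Fintype.card N : ℕ) : ℝ) with hn_def
  set μ : ℝ := m * T.card / n with hμ
  have hμn : (m : ℝ) * T.card = μ * n := (div_mul_cancel₀ _ hn.ne').symm
  clear_value n μ
  have hs1 : ∑ x : Fin m → N, (hits T x : ℝ) = μ * n ^ m := by
    have : n * ∑ x : Fin m → N, (hits T x : ℝ) = n * (μ * n ^ m) := by rw [h1, hμn]; ring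
    exact mul_left_cancel₀ hn.ne' this
  have hs2 : ∑ x : Fin m → N, (hits T x : ℝ) ^ 2 ≤ (μ + μ ^ 2) * n ^ m := by
    have hle : (m * T.card * n + m * (m - 1) * (T.card : ℝ) ^ 2) ≤ n ^ 2 * (μ + μ ^ 2) := by
      have e : n ^ 2 * (μ + μ ^ 2) = m * T.card * n + (m * T.card) ^ 2 := by rw [hμn]; ring
      rw [e]
      have : (0 : ℝ) ≤ m * (T.card : ℝ) ^ 2 := mul_nonneg (Nat.cast_nonneg _) (sq_nonneg _)
      nlinarith
    have : n ^ 2 * ∑ x : Fin m → N, (hits T x : ℝ) ^ 2 ≤ n ^ 2 * ((μ + μ ^ 2) * n ^ m) := by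
      rw [h2, ← mul_assoc]
      gcongr
    exact le_of_mul_le_mul_left this (by positivity)
  rw [hμn] at hm1 hm2
  have hμ1 := le_of_mul_le_mul_right hm1 hn
  have hμ2 := le_of_mul_le_mul_right hm2 hn
  have hq0 : (0 : ℝ) < q := by linarith
  calc (1 - ε) * (q : ℝ) ^ 2 * n ^ m
      ≤ (μ - (μ + μ ^ 2 - 2 * q ^ 2 * μ + q ^ 4) / (2 * q) - q / 2) * n ^ m := by
        gcongr
        -- The numerator is `μ + (μ - q²)²` with `q² - 1 ≤ μ ≤ q²`. The total loss against `q²` is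
        -- then at most `q + 2`, which is below `ε q²` since `ε q ≥ 3`.
        have hd : (μ + μ ^ 2 - 2 * q ^ 2 * μ + q ^ 4) / (2 * q) ≤ q / 2 + 1 := by
          rw [div_le_iff₀ (by positivity)]
          nlinarith [mul_nonneg (sub_nonneg.mpr hμ1) (sub_nonneg.mpr hμ2)]
        nlinarith
    _ = μ * n ^ m - ((μ + μ ^ 2) * n ^ m - 2 * q ^ 2 * (μ * n ^ m) + q ^ 4 * n ^ m) / (2 * q)
          - q / 2 * n ^ m := by ring
    _ ≤ ∑ x : Fin m → N, (hits T x : ℝ) - (∑ x : Fin m → N, (hits T x : ℝ) ^ 2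
          - 2 * q ^ 2 * ∑ x : Fin m → N, (hits T x : ℝ) + q ^ 4 * n ^ m) / (2 * q)
          - q / 2 * n ^ m := by
        rw [hs1]
        gcongr
    _ = ∑ x : Fin m → N, ((hits T x : ℝ) - ((hits T x : ℝ) - q ^ 2) ^ 2 / (2 * q) - q / 2) := by
        have e : ∀ x : Fin m → N, ((hits T x : ℝ) - ((hits T x : ℝ) - q ^ 2) ^ 2 / (2 * q) - q / 2)
            = (1 + 2 * q ^ 2 / (2 * q)) * (hits T x : ℝ) - (hits T x : ℝ) ^ 2 / (2 * q)
              - (q ^ 4 / (2 * q) + q / 2) := fun x => by ring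
        simp only [e, Finset.sum_sub_distrib, ← Finset.mul_sum, ← Finset.sum_div,
          Finset.sum_const, Finset.card_univ, Fintype.card_fun, Fintype.card_fin, nsmul_eq_mul]
        push_cast
        rw [← hn_def]
        ring
    _ ≤ _ := Finset.sum_le_sum fun x _ => le_min_of_sq hq0

end SampleMoments

/-- Deleting a lightest element never lowers the average weight; repeat `t` times. -/
theorem exists_subset_card_mul_sum_le {α : Type} [DecidableEq α] {w : α → ℝ} (s : ℕ) :
    ∀ (t : ℕ) (B : Finset α), B.card = s + t →
      ∃ P ⊆ B, P.card = s ∧ (s : ℝ) * ∑ a ∈ B, w a ≤ B.card * ∑ a ∈ P, w a := by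
  intro t
  induction t with
  | zero => exact fun B hB => ⟨B, subset_rfl, hB, by rw [hB]; simp⟩
  | succ t ih =>
    intro B hB
    obtain ⟨b, hb, hmin⟩ := Finset.exists_min_image B w (Finset.card_pos.mp (by omega))
    have hc : (B.erase b).card = s + t := by rw [Finset.card_erase_of_mem hb]; omega
    obtain ⟨P, hP, hPs, hle⟩ := ih _ hc
    refine ⟨P, hP.trans (Finset.erase_subset _ _), hPs, ?_⟩
    have h1 : (B.erase b).card * w b ≤ ∑ a ∈ B.erase b, w a := by
      rw [← nsmul_eq_mul]
      exact Finset.card_nsmul_le_sum _ _ _ fun a ha => hmin a (Finset.mem_of_mem_erase ha)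
    have hsum := Finset.add_sum_erase B w hb
    have hP1 : (P.card : ℝ) * w b ≤ ∑ a ∈ P, w a := by
      rw [← nsmul_eq_mul]
      exact Finset.card_nsmul_le_sum _ _ _ fun a ha => hmin a (Finset.mem_of_mem_erase (hP ha))
    rw [hPs] at hP1
    rw [hc] at hle
    rw [hB, ← hsum]
    push_cast at hle ⊢
    nlinarith

section heaviest

variable {α : Type} [Fintype α] [DecidableEq α] {s : ℕ}

theorem min_mul_sum_le_sum_heaviest (hs : s ≤ Fintype.card α) {w : α → ℝ} (hw : ∀ a, 0 ≤ w a)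
    (B : Finset α) :
    min 1 ((s : ℝ) / B.card) * ∑ a ∈ B, w a ≤ ∑ a ∈ heaviest s hs w, w a := by
  have hB0 : 0 ≤ ∑ a ∈ B, w a := Finset.sum_nonneg fun a _ => hw a
  rcases le_total B.card s with h | h
  · refine le_trans ?_ (sum_le_sum_heaviest hs w hw h)
    exact mul_le_of_le_one_left hB0 (min_le_left _ _)
  · obtain ⟨t, ht⟩ := Nat.exists_eq_add_of_le h
    obtain ⟨P, -, hPs, hle⟩ := exists_subset_card_mul_sum_le (w := w) s t B ht
    refine le_trans ?_ (sum_le_sum_heaviest hs w hw hPs.le)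
    rcases Nat.eq_zero_or_pos B.card with h0 | h0
    · rw [Finset.card_eq_zero.mp h0, Finset.sum_empty, mul_zero]
      exact Finset.sum_nonneg fun a _ => hw a
    have h0' : (0 : ℝ) < B.card := by exact_mod_cast h0
    calc min 1 ((s : ℝ) / B.card) * ∑ a ∈ B, w a ≤ s / B.card * ∑ a ∈ B, w a := by
          gcongr
          exact min_le_right _ _
      _ = (s * ∑ a ∈ B, w a) / B.card := by ring
      _ ≤ ∑ a ∈ P, w a := by
          rw [div_le_iff₀ h0', mul_comm _ (B.card : ℝ)]
          exact hle

end heaviest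

/-! ### Exchangeability of the elements of `T` in a sample. -/

section Symmetry

variable {N : Type} [Fintype N] [DecidableEq N]

/-- Swapping `t` and `t'` in every coordinate permutes the samples and preserves the hits of `T`. -/
theorem sum_hits_symm {m : ℕ} {T : Finset N} (g : ℕ → ℝ) {t t' : N} (ht : t ∈ T) (ht' : t' ∈ T) :
    ∑ x : Fin m → N, g (hits T x) * hits {t} x = ∑ x : Fin m → N, g (hits T x) * hits {t'} x := by
  refine Fintype.sum_equiv ((Equiv.refl (Fin m)).arrowCongr (Equiv.swap t t')) _ _ fun x => ?_
  have h1 : hits T ((Equiv.refl (Fin m)).arrowCongr (Equiv.swap t t') x) = hits T x := by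
    unfold hits
    congr 1
    ext j
    simp only [Finset.mem_filter, Finset.mem_univ, true_and, Equiv.arrowCongr_apply,
      Equiv.refl_symm, Function.comp_apply, Equiv.refl_apply]
    rw [Equiv.swap_apply_def]
    split_ifs with h h' <;> simp_all
  have h2 : hits {t'} ((Equiv.refl (Fin m)).arrowCongr (Equiv.swap t t') x) = hits {t} x := by
    unfold hits
    congr 1
    ext j
    simp only [Finset.mem_filter, Finset.mem_univ, true_and, Equiv.arrowCongr_apply,
      Equiv.refl_symm, Function.comp_apply, Equiv.refl_apply, Finset.mem_singleton]
    rw [Equiv.swap_apply_eq_iff, Equiv.swap_apply_right]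
  rw [h1, h2]

/-- Given the number of hits, each hit carries on average the mean weight of `T`. -/
theorem card_mul_sum_weight_hits {m : ℕ} {T : Finset N} (g : ℕ → ℝ) (w : N → ℝ) :
    T.card * ∑ x : Fin m → N,
        g (hits T x) * ∑ j ∈ Finset.univ.filter (fun j => x j ∈ T), w (x j)
      = (∑ x : Fin m → N, g (hits T x) * hits T x) * ∑ t ∈ T, w t := by
  rcases T.eq_empty_or_nonempty with rfl | ⟨t₀, ht₀⟩
  · simp
  have h1 : ∑ x : Fin m → N, g (hits T x) * hits T x
      = T.card * ∑ x : Fin m → N, g (hits T x) * hits {t₀} x := by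
    calc ∑ x : Fin m → N, g (hits T x) * hits T x
        = ∑ t ∈ T, ∑ x : Fin m → N, g (hits T x) * hits {t} x := by
          rw [Finset.sum_comm]
          exact Finset.sum_congr rfl fun x _ => by rw [← Finset.mul_sum, sum_hits_singleton]
      _ = ∑ _t ∈ T, ∑ x : Fin m → N, g (hits T x) * hits {t₀} x :=
          Finset.sum_congr rfl fun t ht => sum_hits_symm g ht ht₀
      _ = _ := by rw [Finset.sum_const, nsmul_eq_mul]
  have h2 : ∑ x : Fin m → N,
        g (hits T x) * ∑ j ∈ Finset.univ.filter (fun j => x j ∈ T), w (x j)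
      = (∑ x : Fin m → N, g (hits T x) * hits {t₀} x) * ∑ t ∈ T, w t := by
    simp only [sum_filter_eq_sum_hits, Finset.mul_sum]
    rw [Finset.sum_comm]
    refine Finset.sum_congr rfl fun t ht => ?_
    rw [← sum_hits_symm g ht ht₀, Finset.sum_mul]
    exact Finset.sum_congr rfl fun x _ => by ring
  rw [h1, h2]
  ring

end Symmetry

/-! ### Insertion that never decreases the value. -/

section improve

variable {N : Type} [DecidableEq N]

/-- Insert an element unless this decreases the value. -/
noncomputable def improve (f : Finset N → ℝ) (S : Finset N) (u : N) : Finset N :=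
  if f S ≤ f (insert u S) then insert u S else S

variable {f : Finset N → ℝ}

theorem apply_improve (f : Finset N → ℝ) (S : Finset N) (u : N) :
    f (improve f S u) = f S + max 0 (f (insert u S) - f S) := by
  unfold improve
  split_ifs with h
  · rw [max_eq_right (by linarith)]
    ring
  · rw [max_eq_left (by linarith)]
    ring

theorem apply_improve_union_ge (S T : Finset N) (u : N) :
    f (S ∪ T) + min 0 (f (insert u (S ∪ T)) - f (S ∪ T)) ≤ f (improve f S u ∪ T) := by
  unfold improve
  split_ifs with h
  · rw [Finset.insert_union]
    have := min_le_right 0 (f (insert u (S ∪ T)) - f (S ∪ T))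
    linarith
  · have := min_le_left 0 (f (insert u (S ∪ T)) - f (S ∪ T))
    linarith

theorem subset_improve (S : Finset N) (u : N) : S ⊆ improve f S u := by
  unfold improve
  split_ifs
  · exact Finset.subset_insert _ _
  · exact subset_rfl

theorem card_improve_le (S : Finset N) (u : N) : (improve f S u).card ≤ S.card + 1 := by
  unfold improve
  split_ifs
  · exact Finset.card_insert_le _ _
  · omega

end improve

/-! ### The sampling algorithm. -/

namespace OracleProg

variable {N : Type} [DecidableEq N] [Fintype N] [Nonempty N] {f : Finset N → ℝ} {m s : ℕ}

/-- Sample `m` elements and insert a random one of the `s` best of them. -/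
noncomputable def sampleStep (hs : s ≤ Fintype.card (Fin m)) (hs0 : 0 < s) (S : Finset N) :
    OracleProg N (Finset N) :=
  (uniform (Finset.univ : Finset (Fin m → N)) Finset.univ_nonempty).bind fun x =>
  (ask S).bind fun r =>
  (askAll m fun j => insert (x j) S).bind fun y =>
  (uniform (heaviest s hs fun j => max 0 (y j - r))
    (Finset.card_pos.mp ((card_heaviest hs _).symm ▸ hs0))).bind fun j =>
  pure (if r ≤ y j then insert (x j) S else S)

/-- The positions of a sample among which `sampleStep` chooses. -/
noncomputable def bestPositions (f : Finset N → ℝ) (hs : s ≤ Fintype.card (Fin m)) (S : Finset N)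
    (x : Fin m → N) : Finset (Fin m) :=
  heaviest s hs fun j => max 0 (f (insert (x j) S) - f S)

theorem mean_sampleStep (hs : s ≤ Fintype.card (Fin m)) (hs0 : 0 < s) (S : Finset N)
    (g : Finset N → ℝ) :
    mean f g (sampleStep hs hs0 S)
      = (∑ x, (∑ j ∈ bestPositions f hs S x, g (improve f S (x j))) / s)
        / (Fintype.card N : ℝ) ^ m := by
  simp only [sampleStep, mean_bind, mean_uniform, mean_ask, mean_askAll, mean, card_heaviest,
    Finset.card_univ, Fintype.card_fun, Fintype.card_fin, improve, bestPositions]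
  push_cast
  rfl

theorem costLE_sampleStep (hs : s ≤ Fintype.card (Fin m)) (hs0 : 0 < s) (S : Finset N) :
    (sampleStep hs hs0 S).CostLE (m + 1) := by
  have : m + 1 = 0 + (1 + (m + (0 + 0))) := by omega
  rw [this]
  exact (costLE_uniform _ _).bind fun x => (costLE_ask _).bind fun r =>
    (costLE_askAll _ _).bind fun y => (costLE_uniform _ _).bind fun j => trivial

theorem sure_sampleStep (hs : s ≤ Fintype.card (Fin m)) (hs0 : 0 < s) (S : Finset N) :
    (sampleStep hs hs0 S).Sure f fun S' => S'.card ≤ S.card + 1 := by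
  refine sure_bind (Sure.of_forall _ fun x => sure_bind (Sure.of_forall _ fun r =>
    sure_bind (Sure.of_forall _ fun y => sure_bind (Sure.of_forall _ fun j => ?_))))
  simp only [Sure]
  split_ifs
  · exact Finset.card_insert_le _ _
  · omega

/-- An element fills `m / n` positions on average, and a position is chosen with probability at most
`1/s`. So it is inserted with probability at most `m / (n s) ≤ 1/k`. -/
theorem sampleStep_union_ge (hf : IsSubmodular f) (h0 : ∀ S, 0 ≤ f S) {k : ℕ} (hk : 1 ≤ k)
    (hm : m * k ≤ s * Fintype.card N) (hs : s ≤ Fintype.card (Fin m)) (hs0 : 0 < s)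
    (S T : Finset N) :
    (1 - 1 / (k : ℝ)) * f (S ∪ T) ≤ mean f (fun S' => f (S' ∪ T)) (sampleStep hs hs0 S) := by
  have hn : (0 : ℝ) < Fintype.card N := by exact_mod_cast Fintype.card_pos
  have hs0' : (0 : ℝ) < s := by exact_mod_cast hs0
  have hk' : (0 : ℝ) < k := by exact_mod_cast hk
  set μ : N → ℝ := fun u => min 0 (f (insert u (S ∪ T)) - f (S ∪ T)) with hμ
  have hμ0 : ∀ u, μ u ≤ 0 := fun u => min_le_left _ _
  have h1 : ∑ x : Fin m → N, ∑ j, μ (x j)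
      ≤ ∑ x : Fin m → N, ∑ j ∈ bestPositions f hs S x, μ (x j) := by
    refine Finset.sum_le_sum fun x _ => ?_
    rw [← Finset.sum_sdiff (Finset.subset_univ (bestPositions f hs S x))]
    have := Finset.sum_nonpos (s := Finset.univ \ bestPositions f hs S x)
      fun j _ => hμ0 (x j)
    linarith
  have h2 := sum_fun_sum m μ
  have h3 := hf.neg_le_sum_mul_marginal h0 (p := 1 / (k : ℝ)) (by positivity)
    (q := fun _ => 1 / (k : ℝ)) (fun _ => le_rfl) (S ∪ T)
  rw [← Finset.mul_sum] at h3
  have h4 : ∑ u, μ u ≤ 0 := Finset.sum_nonpos fun u _ => hμ0 u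
  rw [mean_sampleStep]
  have hmk : (m : ℝ) * k ≤ s * Fintype.card N := by exact_mod_cast hm
  set n : ℝ := (Fintype.card N : ℝ)
  have hcard : (∑ x : Fin m → N, (∑ j ∈ bestPositions f hs S x, (f (S ∪ T) + μ (x j))) / s)
      = n ^ m * f (S ∪ T)
        + (∑ x : Fin m → N, ∑ j ∈ bestPositions f hs S x, μ (x j)) / s := by
    simp only [Finset.sum_add_distrib, Finset.sum_const, bestPositions, card_heaviest, add_div,
      nsmul_eq_mul, ← Finset.sum_div, Finset.card_univ, Fintype.card_fun, Fintype.card_fin]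
    rw [mul_div_cancel_left₀ _ hs0'.ne']
    push_cast
    rfl
  have h5 : n ^ m * (1 / k * ∑ u, μ u)
      ≤ (∑ x : Fin m → N, ∑ j ∈ bestPositions f hs S x, μ (x j)) / s := by
    rw [le_div_iff₀ hs0']
    refine le_trans ?_ h1
    refine le_of_mul_le_mul_left ?_ hn
    rw [h2]
    have : s * n / k * ∑ u, μ u ≤ m * ∑ u, μ u := by
      refine mul_le_mul_of_nonpos_right ?_ h4
      rwa [le_div_iff₀ hk']
    calc n * (n ^ m * (1 / k * ∑ u, μ u) * s) = (s * n / k * ∑ u, μ u) * n ^ m := by ring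
      _ ≤ _ := by gcongr
  calc (1 - 1 / (k : ℝ)) * f (S ∪ T)
      = (n ^ m * f (S ∪ T) + n ^ m * (-(1 / k * f (S ∪ T)))) / n ^ m := by
        field_simp
        ring
    _ ≤ (∑ x : Fin m → N, (∑ j ∈ bestPositions f hs S x, (f (S ∪ T) + μ (x j))) / s) / n ^ m := by
        rw [hcard]
        gcongr
        refine le_trans ?_ h5
        gcongr
    _ ≤ _ := by
        gcongr with x _ j _
        exact apply_improve_union_ge S T (x j)

theorem sampleStep_gain_ge (hf : IsSubmodular f) (h0 : ∀ S, 0 ≤ f S) {k q : ℕ} (hk : 1 ≤ k)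
    {ε : ℝ} (hε : 0 < ε) (hε1 : ε ≤ 1) (hq : 3 / ε ≤ q)
    (hm : m * k ≤ q ^ 2 * Fintype.card N)
    (hm' : ((q : ℝ) ^ 2 - 1) * Fintype.card N ≤ (m : ℝ) * k)
    (hs : q ^ 2 ≤ Fintype.card (Fin m)) (hs0 : 0 < q ^ 2) (hkn : k ≤ Fintype.card N)
    (S : Finset N) {T : Finset N} (hT : T.card ≤ k) :
    f S + (f (S ∪ T) - f S) / k - ε * f T / k
      ≤ mean f (fun S' => f S') (sampleStep hs hs0 S) := by
  have hn : (0 : ℝ) < Fintype.card N := by exact_mod_cast Fintype.card_pos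
  have hs0' : (0 : ℝ) < (q ^ 2 : ℕ) := by exact_mod_cast hs0
  have hk' : (0 : ℝ) < k := by exact_mod_cast hk
  -- Padding to exactly `k` elements puts the mean number of hits, `m k / n`, between `q² - 1` and
  -- `q²`.
  obtain ⟨T', hTT', -, hT'⟩ := Finset.exists_subsuperset_card_eq (Finset.subset_univ T) hT
    (by simpa using hkn)
  set w : N → ℝ := fun u => max 0 (f (insert u S) - f S) with hw
  have hw0 : ∀ u, 0 ≤ w u := fun u => le_max_left _ _
  have h1 : f (S ∪ T) - f S ≤ ∑ u ∈ T', w u := calc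
    _ ≤ ∑ u ∈ T, (f (insert u S) - f S) := hf.union_sub_le_sum S T
    _ ≤ ∑ u ∈ T, w u := Finset.sum_le_sum fun u _ => le_max_right _ _
    _ ≤ ∑ u ∈ T', w u := Finset.sum_le_sum_of_subset_of_nonneg hTT' fun u _ _ => hw0 u
  have h2 := hf.union_sub_le h0 S T
  have hT'0 : 0 ≤ ∑ u ∈ T', w u := Finset.sum_nonneg fun u _ => hw0 u
  have h3 : f (S ∪ T) - f S - ε * f T ≤ (1 - ε) * ∑ u ∈ T', w u := by
    rcases le_total (f (S ∪ T) - f S) 0 with h | h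
    · have := mul_nonneg (sub_nonneg.mpr hε1) hT'0
      have := mul_nonneg hε.le (h0 T)
      linarith
    · nlinarith
  -- This `g` is the fraction of the hit weight that `q²` best positions surely capture; times the
  -- number of hits it is the truncated count.
  have h4 := card_mul_sum_weight_hits (m := m) (T := T')
    (fun h => min 1 (((q ^ 2 : ℕ) : ℝ) / h)) w
  have h5 : ∀ x : Fin m → N, min 1 (((q ^ 2 : ℕ) : ℝ) / hits T' x) * hits T' x
      = min (hits T' x : ℝ) ((q : ℝ) ^ 2) := by
    intro x
    rcases Nat.eq_zero_or_pos (hits T' x) with h | h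
    · rw [h]
      simp only [Nat.cast_zero, mul_zero]
      exact (min_eq_left (by positivity)).symm
    · have h' : (0 : ℝ) < hits T' x := by exact_mod_cast h
      rw [min_mul_of_nonneg _ _ h'.le, one_mul, div_mul_cancel₀ _ h'.ne']
      push_cast
      rfl
  simp only [h5, hT'] at h4
  have h6 := sum_min_hits_ge (m := m) (T := T') hε hq hε1 (by rw [hT']; exact_mod_cast hm)
    (by rw [hT']; exact hm') Fintype.card_pos
  have h7 : ∑ x : Fin m → N, min 1 (((q ^ 2 : ℕ) : ℝ) / hits T' x)
        * ∑ j ∈ Finset.univ.filter (fun j => x j ∈ T'), w (x j)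
      ≤ ∑ x : Fin m → N, ∑ j ∈ bestPositions f hs S x, w (x j) :=
    Finset.sum_le_sum fun x _ =>
      min_mul_sum_le_sum_heaviest hs (w := fun j => w (x j)) (fun j => hw0 _) _
  rw [mean_sampleStep]
  set n : ℝ := (Fintype.card N : ℝ)
  simp only [apply_improve]
  have hcard : (∑ x : Fin m → N,
        (∑ j ∈ bestPositions f hs S x, (f S + w (x j))) / (q ^ 2 : ℕ))
      = n ^ m * f S
        + (∑ x : Fin m → N, ∑ j ∈ bestPositions f hs S x, w (x j)) / (q ^ 2 : ℕ) := by
    simp only [Finset.sum_add_distrib, Finset.sum_const, bestPositions, card_heaviest, add_div,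
      nsmul_eq_mul, ← Finset.sum_div, Finset.card_univ, Fintype.card_fun, Fintype.card_fin]
    rw [mul_div_cancel_left₀ _ hs0'.ne']
    push_cast
    rfl
  have h8 : n ^ m * ((f (S ∪ T) - f S - ε * f T) / k)
      ≤ (∑ x : Fin m → N, ∑ j ∈ bestPositions f hs S x, w (x j)) / (q ^ 2 : ℕ) := by
    rw [le_div_iff₀ hs0']
    refine le_trans ?_ h7
    refine le_of_mul_le_mul_left ?_ hk'
    rw [h4]
    calc (k : ℝ) * (n ^ m * ((f (S ∪ T) - f S - ε * f T) / k) * (q ^ 2 : ℕ))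
        = (q : ℝ) ^ 2 * n ^ m * (f (S ∪ T) - f S - ε * f T) := by
          push_cast
          field_simp
      _ ≤ (q : ℝ) ^ 2 * n ^ m * ((1 - ε) * ∑ u ∈ T', w u) := by gcongr
      _ = ((1 - ε) * (q : ℝ) ^ 2 * n ^ m) * ∑ u ∈ T', w u := by ring
      _ ≤ _ := by gcongr
  calc f S + (f (S ∪ T) - f S) / k - ε * f T / k
      = (n ^ m * f S + n ^ m * ((f (S ∪ T) - f S - ε * f T) / k)) / n ^ m := by
        field_simp
        ring
    _ ≤ (∑ x : Fin m → N,
        (∑ j ∈ bestPositions f hs S x, (f S + w (x j))) / (q ^ 2 : ℕ)) / n ^ m := by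
        rw [hcard]
        gcongr

/-- The sampling algorithm: `k` steps, each with a sample of size `⌊n q² / k⌋`. -/
theorem exists_sampling {k : ℕ} (hk : 1 ≤ k) (hkn : k ≤ Fintype.card N) {ε : ℝ} (hε : 0 < ε)
    (hε1 : ε ≤ 1) :
    ∃ p : OracleProg N (Finset N), p.CostLE (Fintype.card N * (⌈3 / ε⌉₊ ^ 2 + 1)) ∧
      ∀ f : Finset N → ℝ, (∀ S, 0 ≤ f S) → IsSubmodular f →
        p.Sure f (fun S => S.card ≤ k) ∧
        ∀ T : Finset N, T.card ≤ k → (1 / Real.exp 1 - ε) * f T ≤ mean f f p := by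
  set q := ⌈3 / ε⌉₊
  set n := Fintype.card N
  have hq : 3 / ε ≤ q := Nat.le_ceil _
  have hs0 : 0 < q ^ 2 := pow_pos (Nat.ceil_pos.mpr (by positivity)) 2
  set m := q ^ 2 * n / k
  have hm : m * k ≤ q ^ 2 * n := Nat.div_mul_le_self _ _
  have hs : q ^ 2 ≤ Fintype.card (Fin m) := by
    rw [Fintype.card_fin, Nat.le_div_iff_mul_le (by omega)]
    exact Nat.mul_le_mul_left _ hkn
  have hm' : ((q : ℝ) ^ 2 - 1) * n ≤ (m : ℝ) * k := by
    -- Rounding the sample size down loses less than `k ≤ n`.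
    have h1 : q ^ 2 * n < m * k + k := by
      have h2 := Nat.div_add_mod (q ^ 2 * n) k
      have h3 := Nat.mod_lt (q ^ 2 * n) (show 0 < k by omega)
      have h4 : k * (q ^ 2 * n / k) = m * k := mul_comm _ _
      omega
    have h2 : (q : ℝ) ^ 2 * n < m * k + k := by exact_mod_cast h1
    have h3 : (k : ℝ) ≤ n := by exact_mod_cast hkn
    linarith
  refine ⟨iter (sampleStep hs hs0) k ∅, ?_, fun f h0 hf => ⟨?_, fun T hT => ?_⟩⟩
  · have h1 := costLE_iter (costLE_sampleStep hs hs0) k (∅ : Finset N)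
    refine h1.mono ?_
    nlinarith
  · refine (sure_iter (P := fun i S => S.card ≤ i) (i := 0) (fun i S hS => ?_) k (by simp)).mono ?_
    · exact (sure_sampleStep hs hs0 S).mono fun S' hS' => by omega
    · intro S hS
      omega
  · have := le_mean_iter_of_empty (f := f) (step := sampleStep hs hs0) (sol := id)
      (Inv := fun _ => True) (pot := fun _ => 0) (loss := fun _ => 0) (err := ε * f T / k)
      (T := T) (a := ∅) hk h0 (fun a _ => Sure.of_forall _ fun _ => trivial)
      (fun S _ => ?_) (fun S _ => sampleStep_union_ge hf h0 hk hm hs hs0 S T)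
      (fun S _ => by rw [mean_const]; simp) (fun _ _ => le_rfl) (fun _ _ => le_rfl)
      (div_nonneg (mul_nonneg hε.le (h0 T)) (Nat.cast_nonneg k)) trivial rfl
    · have hk' : (k : ℝ) ≠ 0 := by positivity
      have e : (k : ℝ) * (ε * f T / k) = ε * f T := by field_simp
      rw [e] at this
      simp only [id] at this
      linarith
    · have := sampleStep_gain_ge hf h0 hk hε hε1 hq hm hm' hs hs0 hkn S hT
      simpa using this

end OracleProg

/-! ### Stored marginal bounds, their refreshing, and the lazy step. -/

/-- `w` bounds all marginals with respect to `S`, and is at least `δ`. -/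
def MarginalBound {N : Type} [DecidableEq N] (f : Finset N → ℝ) (δ : ℝ) (S : Finset N)
    (w : N → ℝ) : Prop :=
  ∀ u, δ ≤ w u ∧ f (insert u S) - f S ≤ w u

namespace MarginalBound

variable {N : Type} [DecidableEq N] {f : Finset N → ℝ} {δ : ℝ} {S : Finset N} {w : N → ℝ}

/-- Diminishing returns keep old bounds valid; for elements already in `S'` the marginal is `0 ≤ δ`.
-/
theorem superset (hf : IsSubmodular f) (hδ : 0 ≤ δ) (h : MarginalBound f δ S w) {S' : Finset N}
    (hS : S ⊆ S') : MarginalBound f δ S' w := by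
  refine fun u => ⟨(h u).1, ?_⟩
  by_cases hu : u ∈ S'
  · rw [Finset.insert_eq_of_mem hu, sub_self]
    exact hδ.trans (h u).1
  · exact (hf.marginal_anti hS hu).trans (h u).2

theorem update (h : MarginalBound f δ S w) (u : N) :
    MarginalBound f δ S (Function.update w u (max (f (insert u S) - f S) δ)) := by
  intro v
  by_cases hv : v = u
  · subst hv
    simp
  · simpa [Function.update_of_ne hv] using h v

end MarginalBound

namespace OracleProg

variable {N : Type} [Fintype N] {k : ℕ} (hk : k ≤ Fintype.card N)

/-- The number of lottery tickets of `u`, roughly proportional to the stored bound. -/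
noncomputable def tickets (w : N → ℝ) (u : N) : ℕ :=
  ⌊k * w u / ∑ v ∈ heaviest k hk w, w v⌋₊ + 1

theorem ticketSet_nonempty (hk0 : 0 < k) (w : N → ℝ) :
    ((heaviest k hk w).sigma fun u => Finset.range (tickets hk w u)).Nonempty := by
  obtain ⟨u, hu⟩ := Finset.card_pos.mp ((card_heaviest hk w).symm ▸ hk0)
  exact ⟨⟨u, 0⟩, by simp [hu, tickets]⟩

variable [DecidableEq N] {f : Finset N → ℝ} (hk0 : 0 < k) (δ : ℝ)

/-- Pick one of the `k` elements of largest stored bound in a lottery, and replace its stored bound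
by its current marginal (or by `δ` if that is larger). -/
noncomputable def refresh (S : Finset N) (w : N → ℝ) : OracleProg N (N → ℝ) :=
  (uniform _ (ticketSet_nonempty hk hk0 w)).bind fun a =>
  (ask S).bind fun r =>
  (ask (insert a.1 S)).bind fun y =>
  pure (Function.update w a.1 (max (y - r) δ))

/-- The relative amount by which the `k` largest stored bounds exceed the true values. -/
noncomputable def staleness (f : Finset N → ℝ) (S : Finset N) (w : N → ℝ) : ℝ :=
  (∑ u ∈ heaviest k hk w, (w u - max (f (insert u S) - f S) δ)) / ∑ u ∈ heaviest k hk w, w u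

/-- The potential of a family of stored bounds. -/
noncomputable def logPotential (w : N → ℝ) : ℝ := ∑ u, Real.log (w u / δ)

variable {δ}

theorem costLE_refresh (S : Finset N) (w : N → ℝ) : (refresh hk hk0 δ S w).CostLE 2 :=
  have h : ∀ a : N, ((ask S).bind fun r => (ask (insert a S)).bind fun y =>
      (pure (Function.update w a (max (y - r) δ)) : OracleProg N (N → ℝ))).CostLE (1 + (1 + 0)) :=
    fun _ => (costLE_ask _).bind fun _ => (costLE_ask _).bind fun _ => trivial
  CostLE.bind (a := 0) (costLE_uniform _ (ticketSet_nonempty hk hk0 w)) fun a => h a.1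

theorem sure_refresh {S : Finset N} {w : N → ℝ} (h : MarginalBound f δ S w) :
    (refresh hk hk0 δ S w).Sure f (MarginalBound f δ S) :=
  sure_bind (Sure.of_forall _ fun a => sure_bind (sure_ask (sure_bind (sure_ask (h.update a.1)))))

theorem sure_iter_refresh {S : Finset N} {w : N → ℝ} (h : MarginalBound f δ S w) (r : ℕ) :
    (iter (refresh hk hk0 δ S) r w).Sure f (MarginalBound f δ S) :=
  sure_iter (P := fun _ => MarginalBound f δ S) (i := 0)
    (fun _ _ hw => sure_refresh hk hk0 hw) r h

theorem mean_refresh (g : (N → ℝ) → ℝ) (S : Finset N) (w : N → ℝ) :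
    mean f g (refresh hk hk0 δ S w)
      = (∑ u ∈ heaviest k hk w, tickets hk w u *
          g (Function.update w u (max (f (insert u S) - f S) δ)))
        / ∑ u ∈ heaviest k hk w, (tickets hk w u : ℝ) := by
  simp only [refresh, mean_bind, mean_uniform, mean_ask, mean, Finset.sum_sigma, Finset.sum_const,
    Finset.card_range, Finset.card_sigma, nsmul_eq_mul]
  push_cast
  rfl

theorem logPotential_nonneg (hδ : 0 < δ) {S : Finset N} {w : N → ℝ} (h : MarginalBound f δ S w) :
    0 ≤ logPotential δ w :=
  Finset.sum_nonneg fun u _ => Real.log_nonneg ((one_le_div hδ).mpr (h u).1)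

/-- Only the term of `u` changes, and `log x ≤ x - 1` applies to the ratio of new to old bound. -/
theorem logPotential_update_le (hδ : 0 < δ) {S : Finset N} {w : N → ℝ}
    (h : MarginalBound f δ S w) (u : N) :
    logPotential δ (Function.update w u (max (f (insert u S) - f S) δ))
      ≤ logPotential δ w - (w u - max (f (insert u S) - f S) δ) / w u := by
  set v := max (f (insert u S) - f S) δ
  have hv : 0 < v := lt_max_of_lt_right hδ
  have hw : 0 < w u := hδ.trans_le (h u).1
  have e : ∀ x : N → ℝ, logPotential δ x
      = Real.log (x u / δ) + ∑ a ∈ Finset.univ.erase u, Real.log (x a / δ) := fun x =>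
    (Finset.add_sum_erase _ _ (Finset.mem_univ u)).symm
  have e2 : ∑ a ∈ Finset.univ.erase u, Real.log (Function.update w u v a / δ)
      = ∑ a ∈ Finset.univ.erase u, Real.log (w a / δ) :=
    Finset.sum_congr rfl fun a ha => by
      rw [Function.update_of_ne (Finset.ne_of_mem_erase ha)]
  rw [e, e w, e2, Function.update_self, Real.log_div hv.ne' hδ.ne', Real.log_div hw.ne' hδ.ne']
  have h1 := Real.log_le_sub_one_of_pos (div_pos hv hw)
  rw [Real.log_div hv.ne' hw.ne'] at h1
  have e3 : (w u - v) / w u = 1 - v / w u := by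
    field_simp
  rw [e3]
  linarith

theorem sum_heaviest_pos (hk0 : 0 < k) (hδ : 0 < δ) {S : Finset N} {w : N → ℝ} (h : MarginalBound f δ S w) :
    0 < ∑ u ∈ heaviest k hk w, w u :=
  Finset.sum_pos (fun u _ => hδ.trans_le (h u).1)
    (Finset.card_pos.mp ((card_heaviest hk w).symm ▸ hk0))

theorem staleness_nonneg (hk0 : 0 < k) (hδ : 0 < δ) {S : Finset N} {w : N → ℝ} (h : MarginalBound f δ S w) :
    0 ≤ staleness hk δ f S w :=
  div_nonneg (Finset.sum_nonneg fun u _ => sub_nonneg.mpr (max_le (h u).2 (h u).1))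
    (sum_heaviest_pos hk hk0 hδ h).le

theorem staleness_le_one (hk0 : 0 < k) (hδ : 0 < δ) {S : Finset N} {w : N → ℝ} (h : MarginalBound f δ S w) :
    staleness hk δ f S w ≤ 1 := by
  refine (div_le_one (sum_heaviest_pos hk hk0 hδ h)).mpr (Finset.sum_le_sum fun u _ => ?_)
  have := le_max_right (f (insert u S) - f S) δ
  linarith

/-- Refreshing `u` gains its excess divided by `w u`. Drawing `u` in proportion to `w u` cancels
this denominator and leaves the staleness. -/
theorem mean_logPotential_refresh_le (hδ : 0 < δ) {S : Finset N} {w : N → ℝ}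
    (h : MarginalBound f δ S w) :
    mean f (logPotential δ) (refresh hk hk0 δ S w)
      ≤ logPotential δ w - staleness hk δ f S w / 2 := by
  have hk' : (0 : ℝ) < k := by exact_mod_cast hk0
  have hW := sum_heaviest_pos hk hk0 hδ h
  have hst := staleness_nonneg hk hk0 hδ h
  rw [mean_refresh]
  set M := heaviest k hk w with hM
  set W := ∑ u ∈ M, w u with hWdef
  have hMc : (M.card : ℝ) = k := by rw [hM, card_heaviest]
  -- The ideal shares `k w / W` add up to `k` over `M`, and rounding adds at most one ticket for
  -- each of its `k` elements. Hence at most `2k` tickets, which is the source of the factor `1/2`.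
  have hc1 : ∀ u, k * w u / W ≤ tickets hk w u := fun u => by
    have := (Nat.lt_floor_add_one (k * w u / W)).le
    simpa [tickets] using this
  have hc2 : ∀ u, (tickets hk w u : ℝ) ≤ k * w u / W + 1 := fun u => by
    have hw : 0 ≤ w u := hδ.le.trans (h u).1
    have := Nat.floor_le (show 0 ≤ k * w u / W by positivity)
    simpa [tickets] using this
  have hC : ∑ u ∈ M, (tickets hk w u : ℝ) ≤ 2 * k := calc
    _ ≤ ∑ u ∈ M, (k * w u / W + 1) := Finset.sum_le_sum fun u _ => hc2 u
    _ = k * (W / W) + k := by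
      rw [Finset.sum_add_distrib, ← Finset.sum_div, ← Finset.mul_sum, Finset.sum_const,
        nsmul_eq_mul, hMc, mul_one, mul_div_assoc]
    _ = 2 * k := by rw [div_self hW.ne']; ring
  have hC0 : 0 < ∑ u ∈ M, (tickets hk w u : ℝ) :=
    Finset.sum_pos (fun u _ => by unfold tickets; positivity)
      (Finset.card_pos.mp ((card_heaviest hk w).symm ▸ hk0))
  have hdrop : k * staleness hk δ f S w
      ≤ ∑ u ∈ M, tickets hk w u * ((w u - max (f (insert u S) - f S) δ) / w u) := by
    have e : k * staleness hk δ f S w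
        = ∑ u ∈ M, k * w u / W * ((w u - max (f (insert u S) - f S) δ) / w u) := by
      change k * ((∑ u ∈ M, (w u - max (f (insert u S) - f S) δ)) / W) = _
      rw [← mul_div_assoc, Finset.mul_sum, Finset.sum_div]
      refine Finset.sum_congr rfl fun u _ => ?_
      have hw : 0 < w u := hδ.trans_le (h u).1
      field_simp
    rw [e]
    refine Finset.sum_le_sum fun u _ => mul_le_mul_of_nonneg_right (hc1 u) ?_
    exact div_nonneg (sub_nonneg.mpr (max_le (h u).2 (h u).1)) (hδ.le.trans (h u).1)
  rw [div_le_iff₀ hC0]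
  calc ∑ u ∈ M, tickets hk w u *
        logPotential δ (Function.update w u (max (f (insert u S) - f S) δ))
      ≤ ∑ u ∈ M, tickets hk w u *
        (logPotential δ w - (w u - max (f (insert u S) - f S) δ) / w u) :=
        Finset.sum_le_sum fun u _ =>
          mul_le_mul_of_nonneg_left (logPotential_update_le hδ h u) (Nat.cast_nonneg _)
    _ = logPotential δ w * ∑ u ∈ M, (tickets hk w u : ℝ)
        - ∑ u ∈ M, tickets hk w u * ((w u - max (f (insert u S) - f S) δ) / w u) := by
        simp only [mul_sub, Finset.sum_sub_distrib, ← Finset.sum_mul]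
        ring
    _ ≤ _ := by nlinarith

theorem mean_logPotential_iter_refresh_le (hδ : 0 < δ) {S : Finset N} {w : N → ℝ}
    (h : MarginalBound f δ S w) (r : ℕ) :
    mean f (logPotential δ) (iter (refresh hk hk0 δ S) r w)
      ≤ logPotential δ w
        - (∑ i ∈ Finset.range r, mean f (staleness hk δ f S) (iter (refresh hk hk0 δ S) i w)) / 2 := by
  induction r with
  | zero => simp [iter, mean]
  | succ r ih =>
    rw [← mean_iter_add, Finset.sum_range_succ]
    have h1 : mean f (fun b => mean f (logPotential δ) (iter (refresh hk hk0 δ S) 1 b))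
          (iter (refresh hk hk0 δ S) r w)
        ≤ mean f (fun b => logPotential δ b - 1 / 2 * staleness hk δ f S b)
          (iter (refresh hk hk0 δ S) r w) := by
      refine mean_mono_of_sure ((sure_iter_refresh hk hk0 h r).mono fun b hb => ?_)
      rw [mean_iter_succ]
      have := mean_logPotential_refresh_le hk hk0 hδ hb
      simp only [iter, mean]
      linarith
    rw [mean_sub, mean_mul_left] at h1
    linarith

/-- One step of the lazy algorithm: refresh stored bounds `m + 1` times, and at a random moment in
between insert a random one of the `k` elements of largest stored bound. -/
noncomputable def lazyStep (δ : ℝ) (m : ℕ) (a : Finset N × (N → ℝ)) :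
    OracleProg N (Finset N × (N → ℝ)) :=
  toss m fun J =>
  (iter (refresh hk hk0 δ a.1) J a.2).bind fun w =>
  (uniform (heaviest k hk w) (Finset.card_pos.mp ((card_heaviest hk w).symm ▸ hk0))).bind fun u =>
  (ask a.1).bind fun r =>
  (ask (insert u a.1)).bind fun y =>
  -- These refreshes still use the old set, so the law of the final bounds depends neither on `J`
  -- nor on `u`.
  (iter (refresh hk hk0 δ a.1) (m + 1 - J) w).bind fun w' =>
  pure (if r ≤ y then insert u a.1 else a.1, w')

variable {m : ℕ}

theorem costLE_lazyStep (a : Finset N × (N → ℝ)) :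
    (lazyStep hk hk0 δ m a).CostLE (2 * (m + 1) + 2) := by
  intro J
  have hJ := J.2
  have : 2 * (m + 1) + 2 = J * 2 + (0 + (1 + (1 + ((m + 1 - J) * 2 + 0)))) := by omega
  rw [this]
  exact (costLE_iter (costLE_refresh hk hk0 _) _ _).bind fun w => (costLE_uniform _ _).bind fun u =>
    (costLE_ask _).bind fun r => (costLE_ask _).bind fun y =>
    (costLE_iter (costLE_refresh hk hk0 _) _ _).bind fun w' => trivial

theorem sure_lazyStep (hf : IsSubmodular f) (hδ : 0 ≤ δ) {a : Finset N × (N → ℝ)}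
    (h : MarginalBound f δ a.1 a.2) :
    (lazyStep hk hk0 δ m a).Sure f fun b =>
      MarginalBound f δ b.1 b.2 ∧ b.1.card ≤ a.1.card + 1 := by
  refine fun J => sure_bind ((sure_iter_refresh hk hk0 h J).mono fun w hw =>
    sure_bind (Sure.of_forall _ fun u => sure_bind (sure_ask (sure_bind (sure_ask
      (sure_bind ((sure_iter_refresh hk hk0 hw _).mono fun w' hw' => ?_)))))))
  exact ⟨hw'.superset hf hδ (subset_improve (f := f) a.1 u), card_improve_le (f := f) a.1 u⟩

theorem mean_lazyStep_set (g : Finset N → ℝ) (a : Finset N × (N → ℝ)) :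
    mean f (fun b => g b.1) (lazyStep hk hk0 δ m a)
      = (∑ J : Fin (m + 1), mean f (fun w => (∑ u ∈ heaviest k hk w, g (improve f a.1 u)) / k)
          (iter (refresh hk hk0 δ a.1) J a.2)) / ((m : ℝ) + 1) := by
  simp only [lazyStep, mean, mean_bind, mean_uniform, mean_ask, mean_const, card_heaviest, improve]

theorem mean_lazyStep_bounds (g : (N → ℝ) → ℝ) (a : Finset N × (N → ℝ)) :
    mean f (fun b => g b.2) (lazyStep hk hk0 δ m a)
      = mean f g (iter (refresh hk hk0 δ a.1) (m + 1) a.2) := by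
  have hk' : (k : ℝ) ≠ 0 := by positivity
  have h : ∀ J : Fin (m + 1), mean f (fun w => mean f g (iter (refresh hk hk0 δ a.1) (m + 1 - J) w))
        (iter (refresh hk hk0 δ a.1) J a.2)
      = mean f g (iter (refresh hk hk0 δ a.1) (m + 1) a.2) := fun J => by
    rw [mean_iter_add]
    congr 2
    omega
  simp only [lazyStep, mean, mean_bind, mean_uniform, mean_ask, card_heaviest, Finset.sum_const,
    nsmul_eq_mul, mul_div_cancel_left₀ _ hk', h, Finset.card_univ, Fintype.card_fin]
  push_cast
  rw [mul_div_cancel_left₀ _ (by positivity)]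

/-- Whatever the stored bounds, the choice is uniform among `k` elements, so each is inserted with
probability at most `1/k`. -/
theorem lazyStep_union_ge (hf : IsSubmodular f) (h0 : ∀ S, 0 ≤ f S) (T : Finset N)
    (a : Finset N × (N → ℝ)) :
    (1 - 1 / (k : ℝ)) * f (a.1 ∪ T)
      ≤ mean f (fun b => f (b.1 ∪ T)) (lazyStep hk hk0 δ m a) := by
  have hk' : (0 : ℝ) < k := by exact_mod_cast hk0
  rw [mean_lazyStep_set (g := fun S => f (S ∪ T)), le_div_iff₀ (by positivity)]
  set R := a.1 ∪ T with hR
  set μ : N → ℝ := fun u => min 0 (f (insert u R) - f R)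
  have hμ0 : ∀ u, μ u ≤ 0 := fun u => min_le_left _ _
  have h1 : ∀ w : N → ℝ, (1 - 1 / (k : ℝ)) * f R
      ≤ (∑ u ∈ heaviest k hk w, f (improve f a.1 u ∪ T)) / k := by
    intro w
    have h2 := hf.neg_le_sum_mul_marginal h0 zero_le_one (q := fun _ => 1) (fun _ => le_rfl) R
    simp only [one_mul] at h2
    have h3 : ∑ u, μ u ≤ ∑ u ∈ heaviest k hk w, μ u := by
      rw [← Finset.sum_sdiff (Finset.subset_univ (heaviest k hk w))]
      have := Finset.sum_nonpos (s := Finset.univ \ heaviest k hk w) fun j _ => hμ0 j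
      linarith
    have h4 : ∑ u ∈ heaviest k hk w, (f R + μ u)
        ≤ ∑ u ∈ heaviest k hk w, f (improve f a.1 u ∪ T) :=
      Finset.sum_le_sum fun u _ => apply_improve_union_ge a.1 T u
    rw [Finset.sum_add_distrib, Finset.sum_const, card_heaviest, nsmul_eq_mul] at h4
    rw [le_div_iff₀ hk']
    have e : (1 - 1 / (k : ℝ)) * f R * k = k * f R - f R := by field_simp
    rw [e]
    linarith
  calc (1 - 1 / (k : ℝ)) * f R * (m + 1) = ∑ _J : Fin (m + 1), (1 - 1 / (k : ℝ)) * f R := by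
        simp [mul_comm]
    _ ≤ _ := by
        refine Finset.sum_le_sum fun J _ => ?_
        rw [← mean_const (f := f) ((1 - 1 / (k : ℝ)) * f R) (iter (refresh hk hk0 δ a.1) J a.2)]
        exact mean_mono_of_sure (Sure.of_forall _ h1)

/-- The `k` largest bounds sum to at least the gain of `T`; a fraction equal to the staleness is
fictitious, and the floor `δ` overstates each marginal by at most `δ`. -/
theorem improve_gain_ge (hk0 : 0 < k) (hf : IsSubmodular f) (h0 : ∀ S, 0 ≤ f S) (hδ : 0 < δ) {T : Finset N}
    (hT : T.card ≤ k) {S : Finset N} {w : N → ℝ} (h : MarginalBound f δ S w) :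
    f S + (f (S ∪ T) - f S) / k - δ - f T / k * staleness hk δ f S w
      ≤ (∑ u ∈ heaviest k hk w, f (improve f S u)) / k := by
  have hk' : (0 : ℝ) < k := by exact_mod_cast hk0
  have hW := sum_heaviest_pos hk hk0 hδ h
  have hρ0 := staleness_nonneg hk hk0 hδ h
  have hρ1 := staleness_le_one hk hk0 hδ h
  have h1 : f (S ∪ T) - f S ≤ ∑ u ∈ heaviest k hk w, w u := calc
    _ ≤ ∑ u ∈ T, (f (insert u S) - f S) := hf.union_sub_le_sum S T
    _ ≤ ∑ u ∈ T, w u := Finset.sum_le_sum fun u _ => (h u).2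
    _ ≤ _ := sum_le_sum_heaviest hk w (fun u => hδ.le.trans (h u).1) hT
  have h2 := hf.union_sub_le h0 S T
  have h3 : staleness hk δ f S w * ∑ u ∈ heaviest k hk w, w u
      = ∑ u ∈ heaviest k hk w, (w u - max (f (insert u S) - f S) δ) :=
    div_mul_cancel₀ _ hW.ne'
  have h4 : ∑ u ∈ heaviest k hk w, (max (f (insert u S) - f S) δ - δ)
      ≤ ∑ u ∈ heaviest k hk w, max 0 (f (insert u S) - f S) := by
    refine Finset.sum_le_sum fun u _ => ?_
    rcases le_total (f (insert u S) - f S) δ with hle | hle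
    · rw [max_eq_right hle, sub_self]
      exact le_max_left _ _
    · rw [max_eq_left hle]
      exact le_trans (by linarith) (le_max_right _ _)
  rw [Finset.sum_sub_distrib] at h3
  simp only [apply_improve]
  rw [Finset.sum_sub_distrib, Finset.sum_const, card_heaviest, nsmul_eq_mul] at h4
  rw [le_div_iff₀ hk', Finset.sum_add_distrib, Finset.sum_const, card_heaviest, nsmul_eq_mul]
  have e : (f S + (f (S ∪ T) - f S) / k - δ - f T / k * staleness hk δ f S w) * k
      = k * f S + (f (S ∪ T) - f S) - k * δ - f T * staleness hk δ f S w := by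
    field_simp
  rw [e]
  set ρ := staleness hk δ f S w
  set W := ∑ u ∈ heaviest k hk w, w u
  have h5 : f (S ∪ T) - f S - f T * ρ ≤ (1 - ρ) * W := by
    rcases le_total (f (S ∪ T) - f S) 0 with hneg | hpos
    · have := mul_nonneg (sub_nonneg.mpr hρ1) hW.le
      have := mul_nonneg (h0 T) hρ0
      linarith
    · nlinarith [mul_le_mul_of_nonneg_left h1 (sub_nonneg.mpr hρ1),
        mul_le_mul_of_nonneg_right h2 hρ0]
  linarith

/-- The uniform moment of insertion replaces the staleness by its average over the refreshes, which
the potential pays for. -/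
theorem lazyStep_gain_ge (hf : IsSubmodular f) (h0 : ∀ S, 0 ≤ f S) (hδ : 0 < δ) {T : Finset N}
    (hT : T.card ≤ k) {a : Finset N × (N → ℝ)} (h : MarginalBound f δ a.1 a.2) :
    f a.1 + (f (a.1 ∪ T) - f a.1) / k
        - f T / (k * (m + 1)) * ∑ i ∈ Finset.range (m + 1),
          mean f (staleness hk δ f a.1) (iter (refresh hk hk0 δ a.1) i a.2) - δ
      ≤ mean f (fun b => f b.1) (lazyStep hk hk0 δ m a) := by
  have hk' : (0 : ℝ) < k := by exact_mod_cast hk0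
  have hm' : (0 : ℝ) < (m : ℝ) + 1 := by positivity
  rw [mean_lazyStep_set, le_div_iff₀ hm']
  have h1 : ∀ i : ℕ, f a.1 + (f (a.1 ∪ T) - f a.1) / k - δ
        - f T / k * mean f (staleness hk δ f a.1) (iter (refresh hk hk0 δ a.1) i a.2)
      ≤ mean f (fun w => (∑ u ∈ heaviest k hk w, f (improve f a.1 u)) / k)
          (iter (refresh hk hk0 δ a.1) i a.2) := fun i => by
    have := mean_mono_of_sure (f := f) ((sure_iter_refresh hk hk0 h i).mono fun w hw =>
      improve_gain_ge hk hk0 hf h0 hδ hT hw)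
    rwa [mean_sub, mean_const, mean_mul_left] at this
  have h2 := Finset.sum_le_sum fun (i : Fin (m + 1)) (_ : i ∈ Finset.univ) => h1 i
  refine le_trans (le_of_eq ?_) h2
  rw [Finset.sum_sub_distrib, Finset.sum_const, Finset.card_univ, Fintype.card_fin, nsmul_eq_mul,
    ← Finset.mul_sum, ← Finset.sum_range fun i =>
      mean f (staleness hk δ f a.1) (iter (refresh hk hk0 δ a.1) i a.2)]
  push_cast
  field_simp
  ring

end OracleProg

/-! ### The lazy algorithm. -/

namespace OracleProg

/-- The lazy algorithm: query all singletons, then make `k` lazy steps. -/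
noncomputable def lazyGreedy {n k : ℕ} (hn : 0 < n) (hk : k ≤ Fintype.card (Fin n)) (hk0 : 0 < k)
    (ε : ℝ) (m : ℕ) : OracleProg (Fin n) (Finset (Fin n)) :=
  (ask ∅).bind fun r =>
  (askAll n fun u => {u}).bind fun y =>
  let W := (Finset.univ.sup' ⟨⟨0, hn⟩, Finset.mem_univ _⟩ fun u => y u - r)
  if W ≤ 0 then pure ∅ else
    (iter (lazyStep hk hk0 (ε * W / k) m) k (∅, fun _ => W)).bind fun a => pure a.1

variable {n k : ℕ} (hn : 0 < n) (hk : k ≤ Fintype.card (Fin n)) (hk0 : 0 < k) {ε : ℝ} {m : ℕ}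

theorem costLE_lazyGreedy :
    (lazyGreedy hn hk hk0 ε m).CostLE (1 + (n + k * (2 * (m + 1) + 2))) := by
  refine (costLE_ask _).bind fun r => (costLE_askAll _ _).bind fun y => ?_
  dsimp only
  split_ifs
  · trivial
  · exact CostLE.bind (b := 0) (costLE_iter (costLE_lazyStep hk hk0) _ _) fun _ => trivial

theorem sure_mean_lazyGreedy {f : Finset (Fin n) → ℝ} (h0 : ∀ S, 0 ≤ f S) (hf : IsSubmodular f)
    (hε : 0 < ε) (hε1 : ε ≤ 1)
    (hm : 2 * n * Real.log (k / ε) ≤ k * ε * (m + 1)) :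
    (lazyGreedy hn hk hk0 ε m).Sure f (fun S => S.card ≤ k) ∧
      ∀ T : Finset (Fin n), T.card ≤ k → (∀ S : Finset (Fin n), S.card ≤ k → f S ≤ f T) →
        (1 / Real.exp 1 - 2 * ε) * f T ≤ mean f f (lazyGreedy hn hk hk0 ε m) := by
  have hk' : (1 : ℝ) ≤ k := by exact_mod_cast hk0
  have hk0' : (0 : ℝ) < k := by linarith
  set W := (Finset.univ.sup' ⟨⟨0, hn⟩, Finset.mem_univ _⟩ fun u => f {u} - f ∅) with hWdef
  have hW : ∀ u, f {u} - f ∅ ≤ W := fun u =>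
    Finset.le_sup' (fun u => f {u} - f ∅) (Finset.mem_univ u)
  have hmean : mean f f (lazyGreedy hn hk hk0 ε m) = mean f f (if W ≤ 0 then pure ∅ else
      (iter (lazyStep hk hk0 (ε * W / k) m) k (∅, fun _ => W)).bind fun a => pure a.1) := by
    simp only [lazyGreedy, mean_bind, mean_ask, mean_askAll]
    rfl
  rw [hmean]
  have hsure : ∀ P, (if W ≤ 0 then pure ∅ else
      (iter (lazyStep hk hk0 (ε * W / k) m) k (∅, fun _ => W)).bind fun a => pure a.1 :
        OracleProg (Fin n) (Finset (Fin n))).Sure f P → (lazyGreedy hn hk hk0 ε m).Sure f P :=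
    fun P h => sure_bind (sure_ask (sure_bind (sure_askAll h)))
  by_cases hW0 : W ≤ 0
  · rw [if_pos hW0] at hsure ⊢
    refine ⟨hsure _ (by simp [Sure]), fun T _ _ => ?_⟩
    have h1 := hf.union_sub_le_sum ∅ T
    rw [Finset.empty_union] at h1
    have h2 : ∑ u ∈ T, (f (insert u ∅) - f ∅) ≤ 0 :=
      Finset.sum_nonpos fun u _ => (hW u).trans hW0
    have h3 : 1 / Real.exp 1 ≤ 1 := by
      rw [div_le_one (Real.exp_pos _)]
      exact Real.one_le_exp zero_le_one
    simp only [mean]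
    nlinarith [h0 T, mul_nonneg hε.le (h0 T)]
  rw [if_neg hW0] at hsure ⊢
  have hWpos : 0 < W := not_le.mp hW0
  -- Over `k` steps the floor costs `k δ = ε W ≤ ε f T`, while the initial potential is only `n log
  -- (W/δ) = n log (k/ε)`.
  set δ := ε * W / k with hδdef
  have hδ : 0 < δ := by positivity
  have hδW : δ ≤ W := by
    rw [hδdef, div_le_iff₀ hk0']
    nlinarith
  have hstart : MarginalBound f δ ∅ fun _ => W := fun u => ⟨hδW, hW u⟩
  constructor
  · refine hsure _ (sure_bind ?_)
    have := sure_iter (f := f) (step := lazyStep hk hk0 δ m)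
      (P := fun i a => MarginalBound f δ a.1 a.2 ∧ a.1.card ≤ i) (i := 0)
      (fun i a ha => (sure_lazyStep hk hk0 hf hδ.le ha.1).mono fun b hb =>
        ⟨hb.1, hb.2.trans (Nat.succ_le_succ ha.2)⟩) k (a := (∅, fun _ => W))
      ⟨hstart, by simp⟩
    exact this.mono fun a ha => by simpa [Sure] using ha.2
  intro T hT hmax
  have hWT : W ≤ f T := by
    refine Finset.sup'_le _ _ fun u _ => ?_
    have := hmax {u} (by rw [Finset.card_singleton]; exact hk0)
    have := h0 ∅
    linarith
  have hc : 0 ≤ 2 * f T / (k * (m + 1)) := by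
    have := h0 T
    positivity
  rw [mean_bind]
  simp only [mean]
  have key := le_mean_iter_of_empty (f := f) (step := lazyStep hk hk0 δ m) (sol := Prod.fst)
    (Inv := fun a => MarginalBound f δ a.1 a.2)
    -- Scaled so that the drop, half the summed staleness, pays the loss exactly; `hm` makes the
    -- initial value at most `ε f T`.
    (pot := fun a => 2 * f T / (k * (m + 1)) * logPotential δ a.2)
    (loss := fun a => f T / (k * (m + 1)) * ∑ i ∈ Finset.range (m + 1),
          mean f (staleness hk δ f a.1) (iter (refresh hk hk0 δ a.1) i a.2)) (err := δ)
    (T := T) (a := (∅, fun _ => W)) hk0 h0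
    (fun a ha => (sure_lazyStep hk hk0 hf hδ.le ha).mono fun b hb => hb.1)
    (fun a ha => lazyStep_gain_ge hk hk0 hf h0 hδ hT ha)
    (fun a _ => lazyStep_union_ge hk hk0 hf h0 T a)
    (fun a ha => ?_) (fun a ha => mul_nonneg hc (logPotential_nonneg hδ ha))
    (fun a ha => ?_) hδ.le hstart rfl
  · refine le_trans ?_ key
    have hlog : logPotential δ (fun _ : Fin n => W) = n * Real.log (k / ε) := by
      have : W / δ = k / ε := by
        rw [hδdef]
        field_simp
      simp [logPotential, this]
    have hkδ : k * δ = ε * W := by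
      rw [hδdef]
      field_simp
    have h2 : 2 * f T / (k * (m + 1)) * (n * Real.log (k / ε)) ≤ ε * f T := by
      rw [div_mul_eq_mul_div, div_le_iff₀ (by positivity)]
      nlinarith [mul_le_mul_of_nonneg_left hm (h0 T)]
    have h3 := mul_le_mul_of_nonneg_left hWT hε.le
    rw [hlog, hkδ]
    linarith
  · rw [mean_mul_left, mean_lazyStep_bounds]
    have := mul_le_mul_of_nonneg_left
      (mean_logPotential_iter_refresh_le hk hk0 hδ ha (m + 1)) hc
    refine this.trans (le_of_eq ?_)
    ring
  · refine mul_nonneg (div_nonneg (h0 T) (by positivity)) (Finset.sum_nonneg fun i _ => ?_)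
    have := mean_mono_of_sure (f := f) ((sure_iter_refresh hk hk0 ha i).mono fun w hw =>
      staleness_nonneg hk hk0 hδ hw)
    rwa [mean_const] at this

end OracleProg

/-! ### Query counts and the choice between the two algorithms. -/

theorem exists_optValue_eq {N : Type} [Fintype N] (f : Finset N → ℝ) (k : ℕ) :
    ∃ T : Finset N, T.card ≤ k ∧ optValue f k = f T ∧ ∀ S : Finset N, S.card ≤ k → f S ≤ f T := by
  obtain ⟨T, hT, hTmax⟩ := Finset.exists_mem_eq_sup'
    (s := Finset.univ.filter fun T : Finset N => T.card ≤ k) ⟨∅, by simp⟩ f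
  refine ⟨T, (Finset.mem_filter.mp hT).2, hTmax, fun S hS => ?_⟩
  rw [← hTmax]
  exact Finset.le_sup' f (by simpa using hS)

theorem one_le_log_div {x ε : ℝ} (hx : 1 ≤ x) (hε : 0 < ε) (hε1 : ε < 1 / Real.exp 1) :
    1 ≤ Real.log (x / ε) := by
  rw [Real.le_log_iff_exp_le (by positivity), le_div_iff₀ hε]
  rw [lt_div_iff₀ (Real.exp_pos 1)] at hε1
  linarith

/-- The guarantee of a procedure for a given query budget. -/
def IsGoodProg (n k : ℕ) (ε : ℝ) (B : ℝ) (p : OracleProg (Fin n) (Finset (Fin n))) : Prop :=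
  ∃ q : ℕ, p.CostLE q ∧ (q : ℝ) ≤ B ∧
    ∀ f : Finset (Fin n) → ℝ, (∀ S, 0 ≤ f S) → IsSubmodular f →
      p.Sure f (fun S => S.card ≤ k) ∧
        (1 / Real.exp 1 - ε) * optValue f k ≤ OracleProg.mean f f p

/-- Disposes of `ε ≥ 1/e`, where the guarantee is vacuous. Below `1/e` the logarithms are at least
`1` and absorb additive constants. -/
theorem isGoodProg_pure_empty {n k : ℕ} {ε : ℝ} (hε : 0 < ε)
    (h : 1 / Real.exp 1 ≤ ε ∨ n = 0) {B : ℝ} (hB : 0 ≤ B) :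
    IsGoodProg n k ε B (.pure ∅) := by
  refine ⟨0, trivial, by simpa using hB, fun f h0 hf => ⟨by simp [OracleProg.Sure], ?_⟩⟩
  obtain ⟨T, -, hTv, -⟩ := exists_optValue_eq f k
  simp only [OracleProg.mean, hTv]
  rcases h with h | rfl
  · nlinarith [h0 T, h0 ∅]
  · rw [Subsingleton.elim T ∅]
    have h3 : 1 / Real.exp 1 ≤ 1 := by
      rw [div_le_one (Real.exp_pos _)]
      exact Real.one_le_exp zero_le_one
    nlinarith [h0 ∅]

theorem optValue_min_card {n k : ℕ} (f : Finset (Fin n) → ℝ) :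
    optValue f k = optValue f (min k n) := by
  obtain ⟨T, hT, hTv, hmax⟩ := exists_optValue_eq f k
  obtain ⟨T', hT', hTv', hmax'⟩ := exists_optValue_eq f (min k n)
  have h : T.card ≤ n := by simpa using Finset.card_le_univ T
  rw [hTv, hTv']
  exact le_antisymm (hmax' T (le_min hT h)) (hmax T' (hT'.trans (min_le_left _ _)))

theorem exists_isGoodProg_sampling {n k : ℕ} {ε : ℝ} (hn : 0 < n) (hk : 1 ≤ k) (hε : 0 < ε)
    (hε1 : ε < 1 / Real.exp 1) : ∃ p, IsGoodProg n k ε (22 * samplingBound n ε) p := by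
  have hε2 : ε ≤ 1 := hε1.le.trans (by
    rw [div_le_one (Real.exp_pos _)]
    exact Real.one_le_exp zero_le_one)
  have : Nonempty (Fin n) := ⟨⟨0, hn⟩⟩
  obtain ⟨p, hp, h⟩ := OracleProg.exists_sampling (N := Fin n) (k := min k n) (by omega)
    (by simp) hε hε2
  rw [Fintype.card_fin] at hp
  refine ⟨p, _, hp, ?_, fun f h0 hf => ⟨(h f h0 hf).1.mono fun S hS => by omega, ?_⟩⟩
  · have hlog := one_le_log_div le_rfl hε hε1
    have hq := (Nat.ceil_lt_add_one (show 0 ≤ 3 / ε by positivity)).le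
    have h1 : 1 ≤ 1 / ε := by rwa [le_div_iff₀ hε, one_mul]
    have h3 : 3 / ε = 3 * (1 / ε) := by ring
    set q : ℝ := (⌈3 / ε⌉₊ : ℝ) with hqdef
    have hq0 : 0 ≤ q := Nat.cast_nonneg _
    -- Here `q ≤ 4/ε`, so `17` would do; `22` is what the lazy algorithm needs.
    have h4 : q ^ 2 + 1 ≤ 22 * (1 / ε) ^ 2 := by
      rw [h3] at hq
      nlinarith
    have hn' : (0 : ℝ) ≤ n := Nat.cast_nonneg n
    push_cast
    rw [← hqdef]
    calc (n : ℝ) * (q ^ 2 + 1) ≤ n * (22 * (1 / ε) ^ 2) := by gcongr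
      _ = 22 * (n / ε ^ 2 * 1) := by ring
      _ ≤ 22 * (n / ε ^ 2 * Real.log (1 / ε)) := by gcongr
  · obtain ⟨T, hT, hTv, -⟩ := exists_optValue_eq f (min k n)
    rw [optValue_min_card, hTv]
    exact (h f h0 hf).2 T hT

theorem exists_isGoodProg_lazy {n k : ℕ} {ε : ℝ} (hn : 0 < n) (hk : 1 ≤ k) (hε : 0 < ε)
    (hε1 : ε < 1 / Real.exp 1) : ∃ p, IsGoodProg n k ε (22 * thresholdBound n k ε) p := by
  have hε2 : ε ≤ 1 := hε1.le.trans (by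
    rw [div_le_one (Real.exp_pos _)]
    exact Real.one_le_exp zero_le_one)
  set l := min k n with hl
  have hl0 : 0 < l := by omega
  have hln : l ≤ Fintype.card (Fin n) := by simp [hl]
  have hl1 : (1 : ℝ) ≤ l := by exact_mod_cast hl0
  have hl2 : (l : ℝ) ≤ n := by exact_mod_cast min_le_right k n
  have hl3 : (l : ℝ) ≤ k := by exact_mod_cast min_le_left k n
  have hlpos : (0 : ℝ) < l := by linarith
  have hL := one_le_log_div hl1 hε hε1
  have hL' : Real.log (l / ε) ≤ Real.log (k / ε) :=
    Real.log_le_log (by positivity) (by gcongr)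
  have hL2 : Real.log (l / (ε / 2)) ≤ 2 * Real.log (l / ε) := by
    have e : (l : ℝ) / (ε / 2) = 2 * (l / ε) := by ring
    rw [e, Real.log_mul two_ne_zero (by positivity)]
    have := Real.log_two_lt_d9
    linarith
  set m := ⌊2 * n * Real.log (l / (ε / 2)) / (l * (ε / 2))⌋₊ with hm
  have hm1 : 2 * n * Real.log (l / (ε / 2)) ≤ l * (ε / 2) * (m + 1) := by
    have := (Nat.lt_floor_add_one (2 * n * Real.log (l / (ε / 2)) / (l * (ε / 2)))).le
    rw [div_le_iff₀ (by positivity), ← hm] at this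
    linarith
  refine ⟨_, _, OracleProg.costLE_lazyGreedy hn hln hl0 (ε := ε / 2) (m := m), ?_,
    fun f h0 hf => ?_⟩
  · have hLL : 0 ≤ Real.log (l / (ε / 2)) := Real.log_nonneg (by
      rw [le_div_iff₀ (by positivity)]
      linarith)
    have hm2 : l * (m : ℝ) ≤ 8 * (n / ε * Real.log (k / ε)) := by
      have h1 := Nat.floor_le (show 0 ≤ 2 * n * Real.log (l / (ε / 2)) / (l * (ε / 2)) by
        positivity)
      calc l * (m : ℝ) ≤ l * (2 * n * Real.log (l / (ε / 2)) / (l * (ε / 2))) := by gcongr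
        _ = 4 * (n / ε) * Real.log (l / (ε / 2)) := by
          field_simp
          ring
        _ ≤ 4 * (n / ε) * (2 * Real.log (k / ε)) := by
          gcongr
          linarith
        _ = _ := by ring
    have hn1 : (1 : ℝ) ≤ n := by linarith
    have h2 : (n : ℝ) ≤ n / ε * Real.log (k / ε) := by
      have h3 : (n : ℝ) ≤ n / ε := by
        rw [le_div_iff₀ hε]
        nlinarith
      nlinarith
    have h4 : 0 ≤ (k : ℝ) * Real.sqrt ((n : ℝ) / ε * Real.log ((k : ℝ) / ε)) := by positivity
    unfold thresholdBound
    push_cast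
    -- With `X = (n/ε) log (k/ε) ≥ n`, the count `1 + n + 2 l m + 4 l` is at most `16 X + 6 n ≤ 22
    -- X`; the square-root term is only dropped.
    nlinarith
  · obtain ⟨h1, h2⟩ := OracleProg.sure_mean_lazyGreedy hn hln hl0 h0 hf (ε := ε / 2) (m := m)
      (by positivity) (by linarith) hm1
    refine ⟨h1.mono fun S hS => by omega, ?_⟩
    obtain ⟨T, hT, hTv, hmax⟩ := exists_optValue_eq f l
    rw [optValue_min_card, ← hl, hTv]
    have := h2 T hT hmax
    rwa [mul_div_cancel₀ ε two_ne_zero] at this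

theorem samplingBound_nonneg (n : ℕ) {ε : ℝ} (hε : 0 < ε) (hε1 : ε ≤ 1) :
    0 ≤ samplingBound n ε :=
  mul_nonneg (by positivity) (Real.log_nonneg (by rwa [le_div_iff₀ hε, one_mul]))

theorem thresholdBound_nonneg (n : ℕ) {k : ℕ} {ε : ℝ} (hk : 1 ≤ k) (hε : 0 < ε) (hε1 : ε ≤ 1) :
    0 ≤ thresholdBound n k ε := by
  have hk' : (1 : ℝ) ≤ k := by exact_mod_cast hk
  have : 0 ≤ Real.log (k / ε) := Real.log_nonneg (by
    rw [le_div_iff₀ hε]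
    linarith)
  unfold thresholdBound
  positivity

theorem exists_isGoodProg {n k : ℕ} {ε : ℝ} (hk : 1 ≤ k) (hε : 0 < ε) (hε1 : ε ≤ 1) :
    ∃ p, IsGoodProg n k ε (22 * min (samplingBound n ε) (thresholdBound n k ε)) p := by
  by_cases h : 1 / Real.exp 1 ≤ ε ∨ n = 0
  · exact ⟨_, isGoodProg_pure_empty hε h (mul_nonneg (by norm_num)
      (le_min (samplingBound_nonneg n hε hε1) (thresholdBound_nonneg n hk hε hε1)))⟩
  · push Not at h
    rcases le_total (samplingBound n ε) (thresholdBound n k ε) with hle | hle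
    · rw [min_eq_left hle]
      exact exists_isGoodProg_sampling (Nat.pos_of_ne_zero h.2) hk hε h.1
    · rw [min_eq_right hle]
      exact exists_isGoodProg_lazy (Nat.pos_of_ne_zero h.2) hk hε h.1

theorem theorem1p4 :
    ∃ (C : ℝ) (alg : (n : ℕ) → (k : ℕ) → (ε : ℝ) → OracleAlg (Fin n)), 0 < C ∧
      ∀ (n k : ℕ) (ε : ℝ), 1 ≤ k → 0 < ε → ε ≤ 1 →
        ∀ f : Finset (Fin n) → ℝ, (∀ S, 0 ≤ f S) → IsSubmodular f →
          -- every run outputs a feasible solution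
          (alg n k ε).Always f (fun S _ => S.card ≤ k) ∧
          -- approximation guarantee, in expectation
          (1 / Real.exp 1 - ε) * optValue f k ≤ (alg n k ε).expectedValue f ∧
          -- number of queries, in expectation
          (alg n k ε).expectedQueries f
            ≤ C * min (samplingBound n ε) (thresholdBound n k ε) ∧
          -- the first bound, where it is the smaller one, holds in every run
          (samplingBound n ε ≤ thresholdBound n k ε →
            (alg n k ε).Always f (fun _ q => (q : ℝ) ≤ C * samplingBound n ε)) := by
  classical
  -- The procedure is chosen before `f`, since `IsGoodProg` quantifies over `f` inside.
  refine ⟨22, fun n k ε => if h : 1 ≤ k ∧ 0 < ε ∧ ε ≤ 1 then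
    (exists_isGoodProg (n := n) h.1 h.2.1 h.2.2).choose.run else .done ∅, by norm_num,
    fun n k ε hk hε hε1 f h0 hf => ?_⟩
  have hcond : 1 ≤ k ∧ 0 < ε ∧ ε ≤ 1 := ⟨hk, hε, hε1⟩
  simp only [dif_pos hcond]
  obtain ⟨q, hq, hqB, h⟩ := (exists_isGoodProg (n := n) hk hε hε1).choose_spec
  obtain ⟨hcard, hval⟩ := h f h0 hf
  refine ⟨OracleProg.always_run hcard hq fun S _ hS _ => hS, ?_, ?_, fun hle => ?_⟩
  · rw [OracleAlg.expectedValue, OracleProg.expect_run]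
    exact hval
  · refine OracleAlg.expect_le_of_always (OracleProg.always_run hcard hq fun S c _ hc => ?_)
    exact le_trans (by exact_mod_cast hc) hqB
  · rw [min_eq_left hle] at hqB
    refine OracleProg.always_run hcard hq fun S c _ hc => ?_
    exact le_trans (by exact_mod_cast hc) hqB
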